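/- Let $\mathcal X$ be a complex Hilbert space, let $B$ be a selfadjoint operator in $\mathcal X$ with dense domain $D(B)$, and let $J$ be a bounded linear operator on $\mathcal X$ with $J^*=-J$ and $J^2=-1$. Assume that the spectrum satisfies $\sigma(B)\subset[\delta,\infty)$ for some $\delta>0$. Then $B$ has a nonnegative selfadjoint square root. Let $\Lambda=B^{1/2}$ be the nonnegative selfadjoint operator with $\Lambda^2=B$, let $\mathcal V=D(\Lambda)$ with the norm $\|x\|_{\mathcal V}=\|\Lambda x\|_{\mathcal X}$, and let $H=\Lambda\, iJ\Lambda$ with domain $D(H)=\{x\in\mathcal V:\ J\Lambda x\in\mathcal V\}$. Then $\Lambda:\mathcal V\to\mathcal X$ is bijective, and $H$ is selfadjoint and has a spectral resolution $E$. By this we mean an increasing, strongly right-continuous family $(E(\omega))_{\omega\in\mathbb R}$ of orthogonal projections in $\mathcal X$, tending strongly to $0$ as $\omega\to-\infty$ and to the identity as $\omega\to\infty$, such that $H=\int\omega\,dE(\omega)$, i.e. $Z\in D(H)$ if and only if $\int\omega\,dE(\omega)Z$ converges in $\mathcal X$, and then $HZ=\int\omega\,dE(\omega)Z$. The integrals over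 $\mathbb R$ are limits in the norm of $\mathcal X$, as $a\to-\infty$ and $b\to\infty$, of Riemann–Stieltjes integrals over $[a,b]$. A solution of $\dot X(t)=JBX(t)$, $t\in\mathbb R$, is a function $X\in C(\mathbb R,\mathcal V)$ such that, for every $t\in\mathbb R$, $\int_0^tX(s)\,ds\in D(B)$ and $$X(t)-X(0)=JB\int_0^tX(s)\,ds .$$ For every initial value $X(0)\in\mathcal V$ there is a solution. For every spectral resolution $E$ of $H$, every solution $X$ and every $t\in\mathbb R$, the integral below converges in $\mathcal X$, and $$X(t)=\Lambda^{-1}\int e^{-i\omega t}\,dE(\omega)\,\Lambda X(0).$$ -/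

import Mathlib

open Filter Topology Set

noncomputable section

namespace ComplexHamilton

/-- The composition `g ∘ f` of two partially defined operators on its natural (maximal) domain
`{x ∈ D(f) | f x ∈ D(g)}`. -/
def comp {E : Type*} [AddCommGroup E] [Module ℂ E] (g f : E →ₗ.[ℂ] E) : E →ₗ.[ℂ] E where
  domain :=
    { carrier := {x | ∃ h : x ∈ f.domain, f ⟨x, h⟩ ∈ g.domain}
      zero_mem' := ⟨f.domain.zero_mem, by
        have h0 : f ⟨0, f.domain.zero_mem⟩ = 0 := f.map_zero
        rw [h0]; exact g.domain.zero_mem⟩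
      add_mem' := by
        rintro x y ⟨hx, hx'⟩ ⟨hy, hy'⟩
        refine ⟨f.domain.add_mem hx hy, ?_⟩
        have h0 : f ⟨x + y, f.domain.add_mem hx hy⟩ = f ⟨x, hx⟩ + f ⟨y, hy⟩ :=
          f.map_add ⟨x, hx⟩ ⟨y, hy⟩
        rw [h0]; exact g.domain.add_mem hx' hy'
      smul_mem' := by
        rintro c x ⟨hx, hx'⟩
        refine ⟨f.domain.smul_mem c hx, ?_⟩
        have h0 : f ⟨c • x, f.domain.smul_mem c hx⟩ = c • f ⟨x, hx⟩ := f.map_smul c ⟨x, hx⟩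
        rw [h0]; exact g.domain.smul_mem c hx' }
  toFun :=
    { toFun := fun x => g ⟨f ⟨x.1, x.2.1⟩, x.2.2⟩
      map_add' := by
        rintro ⟨x, hx, hx'⟩ ⟨y, hy, hy'⟩
        rw [← g.map_add]
        congr 1
        exact Subtype.ext (f.map_add ⟨x, hx⟩ ⟨y, hy⟩)
      map_smul' := by
        rintro c ⟨x, hx, hx'⟩
        rw [RingHom.id_apply, ← g.map_smul]
        congr 1
        exact Subtype.ext (f.map_smul c ⟨x, hx⟩) }

variable {𝒳 : Type*} [NormedAddCommGroup 𝒳] [InnerProductSpace ℂ 𝒳]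

/-- The resolvent set of a (possibly unbounded) operator `T`: the numbers `z` for which
`T - z : D(T) → 𝒳` is a bijection with bounded inverse `R`. -/
def resolventSet (T : 𝒳 →ₗ.[ℂ] 𝒳) : Set ℂ :=
  {z | ∃ R : 𝒳 →L[ℂ] 𝒳,
      (∀ y : 𝒳, ∃ h : R y ∈ T.domain, T ⟨R y, h⟩ - z • R y = y) ∧
      (∀ x : T.domain, R (T x - z • (x : 𝒳)) = x)}

/-- The spectrum of a (possibly unbounded) operator. -/
def spectrum (T : 𝒳 →ₗ.[ℂ] 𝒳) : Set ℂ := (resolventSet T)ᶜ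

/-- `Λ = B^{1/2}`: `Λ` is selfadjoint and nonnegative and `Λ² = B`, equality of domains included. -/
structure IsPositiveSqrt [CompleteSpace 𝒳] (Λ B : 𝒳 →ₗ.[ℂ] 𝒳) : Prop where
  selfAdjoint : IsSelfAdjoint Λ
  nonneg : ∀ x : Λ.domain, 0 ≤ (inner ℂ (Λ x) (x : 𝒳)).re
  sq_eq : comp Λ Λ = B

/-- The Hamilton generator `A = J B`, with domain `D(B)`. -/
def generator (J : 𝒳 →L[ℂ] 𝒳) (B : 𝒳 →ₗ.[ℂ] 𝒳) : 𝒳 →ₗ.[ℂ] 𝒳 :=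
  (J : 𝒳 →ₗ[ℂ] 𝒳).compPMap B

/-- The operator `H = Λ i J Λ`, with domain `{x ∈ D(Λ) | i J Λ x ∈ D(Λ)}`. -/
def schrodinger (J : 𝒳 →L[ℂ] 𝒳) (Λ : 𝒳 →ₗ.[ℂ] 𝒳) : 𝒳 →ₗ.[ℂ] 𝒳 :=
  comp Λ (((Complex.I • J : 𝒳 →L[ℂ] 𝒳) : 𝒳 →ₗ[ℂ] 𝒳).compPMap Λ)

/-- Mild solutions of class `C(ℝ, 𝒱)` of `Ẋ = J B X`. Here `𝒱 = D(Λ)` carries the norm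
`‖x‖_𝒱 = ‖Λ x‖`, so that continuity into `𝒱` is continuity of `t ↦ Λ (X t)`. The equation is
`X(t) - X(0) = A ∫₀ᵗ X(s) ds` for all real `t`, where the integral has to lie in `D(A)`. -/
structure IsMildSolution (J : 𝒳 →L[ℂ] 𝒳) (B Λ : 𝒳 →ₗ.[ℂ] 𝒳) (X : ℝ → Λ.domain) : Prop where
  continuous : Continuous fun t => Λ (X t)
  equation : ∀ t : ℝ, ∃ h : (∫ s in (0 : ℝ)..t, (X s : 𝒳)) ∈ (generator J B).domain,
    (X t : 𝒳) - X 0 = generator J B ⟨∫ s in (0 : ℝ)..t, (X s : 𝒳), h⟩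

/-- `I` is the Riemann–Stieltjes integral `∫_a^b f(ω) dF(ω)`: the limit in norm of the sums over
tagged partitions `a = p 0 ≤ p 1 ≤ … ≤ p n = b`, `ξ i ∈ [p i, p (i+1)]`, as the mesh tends to zero. -/
def HasRSIntegral (f : ℝ → ℂ) (F : ℝ → 𝒳) (a b : ℝ) (I : 𝒳) : Prop :=
  ∀ ε > (0 : ℝ), ∃ η > (0 : ℝ), ∀ (n : ℕ) (p ξ : ℕ → ℝ),
    p 0 = a → p n = b →
    (∀ i < n, ξ i ∈ Icc (p i) (p (i + 1)) ∧ p (i + 1) - p i < η) →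
    ‖(∑ i ∈ Finset.range n, f (ξ i) • (F (p (i + 1)) - F (p i))) - I‖ < ε

/-- `I` is the improper Riemann–Stieltjes integral `∫_{-∞}^{∞} f(ω) dF(ω)`: the integrals over all
compact intervals `[a, b]` exist and converge to `I` in norm as `a → -∞` and `b → ∞`. -/
def HasImproperRSIntegral (f : ℝ → ℂ) (F : ℝ → 𝒳) (I : 𝒳) : Prop :=
  ∃ K : ℝ → ℝ → 𝒳, (∀ a b : ℝ, a ≤ b → HasRSIntegral f F a b (K a b)) ∧
    Tendsto (fun q : ℝ × ℝ => K q.1 q.2) (atBot ×ˢ atTop) (𝓝 I)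

/-- A spectral family (resolution of the identity): an increasing, strongly right-continuous family
of orthogonal projections that tends strongly to `0` at `-∞` and to the identity at `∞`. -/
structure IsSpectralFamily [CompleteSpace 𝒳] (E : ℝ → 𝒳 →L[ℂ] 𝒳) : Prop where
  projection : ∀ ω, IsStarProjection (E ω)
  monotone : ∀ ω ω', ω ≤ ω' → E ω ∘L E ω' = E ω
  rightContinuous : ∀ (ω : ℝ) (Z : 𝒳), Tendsto (fun s => E s Z) (𝓝[>] ω) (𝓝 (E ω Z))
  atBot : ∀ Z : 𝒳, Tendsto (fun ω => E ω Z) atBot (𝓝 0)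
  atTop : ∀ Z : 𝒳, Tendsto (fun ω => E ω Z) atTop (𝓝 Z)

/-- `E` is the spectral resolution of the operator `H`, that is `H = ∫ ω dE(ω)`: a vector `Z` lies in
`D(H)` if and only if the integral `∫ ω dE(ω) Z` converges in norm, and then `H Z` is its value. -/
structure IsSpectralResolution [CompleteSpace 𝒳] (E : ℝ → 𝒳 →L[ℂ] 𝒳) (H : 𝒳 →ₗ.[ℂ] 𝒳) :
    Prop where
  family : IsSpectralFamily E
  integral : ∀ Z W : 𝒳, (∃ h : Z ∈ H.domain, H ⟨Z, h⟩ = W) ↔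
    HasImproperRSIntegral (fun ω => (ω : ℂ)) (fun ω => E ω Z) W

end ComplexHamilton

end

/-!
With `S = Λ⁻¹`, which is bounded, `H = Λ iJ Λ` has the bounded selfadjoint inverse `K = S (iJ)⁻¹ S`.
The spectral projection of `H` for `(-∞, ω]` is the projection onto the kernel of the positive part
of `κ - ω κ²`, evaluated at `κ = K`. A spectral family `E` resolves `K⁻¹` if and only if it commutes
with `K` and, on the range of `E q - E p`, `K⁻¹` is within `q - p` of every `c ∈ [p, q]`. As the
ranges belonging to disjoint intervals are orthogonal, Pythagoras' theorem turns such bounds on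
single intervals into the convergence of Riemann–Stieltjes sums.

For `Y = Λ X` the Hamilton equation reads `∫₀ᵗ Y = i K (Y(t) - Y(0))`. On the range of `E q - E p`
this is a Schrödinger equation with a bounded operator within `q - p` of `c ∈ [p, q]`, whose
solutions conserve the norm and differ from `exp(-i c t) Y(0)` by at most `|t| (q - p) ‖Y(0)‖`.
Conservation of the norm also makes the set of initial values of solutions closed.
-/

noncomputable section

namespace ComplexHamilton

section BoundedInverse

variable {𝒳 : Type*} [NormedAddCommGroup 𝒳] [InnerProductSpace ℂ 𝒳]

/-- The bounded, everywhere defined operator `R` is the inverse of the possibly unbounded operator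
`T`: the graph of `T` consists of the pairs `(R W, W)`. -/
def HasInverse (T : 𝒳 →ₗ.[ℂ] 𝒳) (R : 𝒳 →L[ℂ] 𝒳) : Prop :=
  ∀ Z W : 𝒳, (∃ h : Z ∈ T.domain, T ⟨Z, h⟩ = W) ↔ R W = Z

namespace HasInverse

variable {T T' : 𝒳 →ₗ.[ℂ] 𝒳} {R R' : 𝒳 →L[ℂ] 𝒳}

lemma mem (h : HasInverse T R) (W : 𝒳) : R W ∈ T.domain :=
  ((h (R W) W).2 rfl).1

lemma apply_inverse (h : HasInverse T R) (W : 𝒳) : T ⟨R W, h.mem W⟩ = W :=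
  ((h (R W) W).2 rfl).2

lemma inverse_apply (h : HasInverse T R) (x : T.domain) : R (T x) = x :=
  (h x (T x)).1 ⟨x.2, rfl⟩

lemma injective (h : HasInverse T R) : Function.Injective R := fun W W' e =>
  calc W = T ⟨R W, h.mem W⟩ := (h.apply_inverse W).symm
    _ = T ⟨R W', h.mem W'⟩ := congrArg T (Subtype.ext e)
    _ = W' := h.apply_inverse W'

lemma bijective (h : HasInverse T R) : Function.Bijective (fun x : T.domain => T x) := by
  refine ⟨fun x y e => Subtype.ext ?_, fun W => ⟨⟨R W, h.mem W⟩, h.apply_inverse W⟩⟩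
  rw [← h.inverse_apply x, ← h.inverse_apply y]
  exact congrArg R e

lemma unique (h : HasInverse T R) (h' : HasInverse T R') : R = R' :=
  ContinuousLinearMap.ext fun W => ((h' _ W).1 ⟨h.mem W, h.apply_inverse W⟩).symm

lemma domain_eq_range (h : HasInverse T R) : T.domain = (R : 𝒳 →ₗ[ℂ] 𝒳).range :=
  le_antisymm (fun Z hZ => ⟨T ⟨Z, hZ⟩, h.inverse_apply ⟨Z, hZ⟩⟩) (by
    rintro _ ⟨W, rfl⟩
    exact h.mem W)

lemma ext (h : HasInverse T R) (h' : HasInverse T' R) : T = T' :=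
  LinearPMap.ext (h.domain_eq_range.trans h'.domain_eq_range.symm) fun Z hZ hZ' =>
    h.injective ((h.inverse_apply ⟨Z, hZ⟩).trans (h'.inverse_apply ⟨Z, hZ'⟩).symm)

lemma comp (h : HasInverse T R) (h' : HasInverse T' R') :
    HasInverse (comp T T') (R' * R) := by
  intro Z W
  constructor
  · rintro ⟨⟨hZ, hTZ⟩, hW⟩
    have hRW : R W = T' ⟨Z, hZ⟩ := (h _ _).1 ⟨hTZ, hW⟩
    rw [mul_apply_eq_comp, hRW, h'.inverse_apply]
  · intro e
    obtain ⟨hZ, hRW⟩ := (h' Z (R W)).2 e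
    obtain ⟨hTZ, hW⟩ := (h (T' ⟨Z, hZ⟩) W).2 hRW.symm
    exact ⟨⟨hZ, hTZ⟩, hW⟩

lemma compPMap (h : HasInverse T R) (U : (𝒳 →L[ℂ] 𝒳)ˣ) :
    HasInverse (((U : 𝒳 →L[ℂ] 𝒳) : 𝒳 →ₗ[ℂ] 𝒳).compPMap T) (R * ↑U⁻¹) := by
  intro Z W
  have hU : ∀ V, (U : 𝒳 →L[ℂ] 𝒳) V = W ↔ V = (↑U⁻¹ : 𝒳 →L[ℂ] 𝒳) W := fun V =>
    ⟨fun e => by rw [← e]; exact (DFunLike.congr_fun U.inv_mul V).symm,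
      fun e => by rw [e]; exact DFunLike.congr_fun U.mul_inv W⟩
  exact (exists_congr fun hZ => hU (T ⟨Z, hZ⟩)).trans (h Z _)

lemma exists_of_injective (hR : Function.Injective R) : ∃ T, HasInverse T R := by
  let e := LinearEquiv.ofInjective (R : 𝒳 →ₗ[ℂ] 𝒳) hR
  refine ⟨⟨(R : 𝒳 →ₗ[ℂ] 𝒳).range, (e.symm : _ →ₗ[ℂ] 𝒳)⟩, fun Z W => ⟨?_, ?_⟩⟩
  · rintro ⟨hZ, rfl⟩
    exact congrArg Subtype.val (e.apply_symm_apply ⟨Z, hZ⟩)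
  · rintro rfl
    exact ⟨⟨W, rfl⟩, e.symm_apply_apply W⟩

lemma inverse_eq (h : HasInverse T R) (x : T.domain) :
    ∃ hx : T x ∈ T.inverse.domain, (x : 𝒳) = T.inverse ⟨T x, hx⟩ :=
  ⟨LinearPMap.inverse_domain.ge ⟨x, rfl⟩,
    (LinearPMap.inverse_apply_eq (LinearMap.ker_eq_bot.2 h.bijective.1) rfl).symm⟩

end HasInverse

lemma bijective_of_zero_mem_resolventSet {T : 𝒳 →ₗ.[ℂ] 𝒳} (h : (0 : ℂ) ∈ resolventSet T) :
    Function.Bijective (fun x : T.domain => T x) := by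
  obtain ⟨R, hTR, hRT⟩ := h
  simp only [zero_smul, sub_zero] at hTR hRT
  refine ⟨fun x y e => Subtype.ext ?_, fun W => ?_⟩
  · rw [← hRT x, ← hRT y]
    exact congrArg R e
  · obtain ⟨hW, e⟩ := hTR W
    exact ⟨⟨R W, hW⟩, e⟩

lemma bijective_of_bijective_comp_self {T : 𝒳 →ₗ.[ℂ] 𝒳}
    (h : Function.Bijective (fun x : (comp T T).domain => comp T T x)) :
    Function.Bijective (fun x : T.domain => T x) := by
  refine ⟨(injective_iff_map_eq_zero T.toFun).2 fun x (hx : T x = 0) => ?_, fun W => ?_⟩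
  · have hmem : T x ∈ T.domain := hx ▸ T.domain.zero_mem
    have hTT : T ⟨T x, hmem⟩ = 0 :=
      (congrArg T (Subtype.ext hx : (⟨T x, hmem⟩ : T.domain) = 0)).trans T.map_zero
    have hzero : (⟨x, x.2, hmem⟩ : (comp T T).domain) = 0 :=
      h.1 (hTT.trans (comp T T).map_zero.symm)
    exact Subtype.ext (congrArg (fun y : (comp T T).domain => (y : 𝒳)) hzero)
  · obtain ⟨x, hx⟩ := h.2 W
    exact ⟨⟨T ⟨x, x.2.1⟩, x.2.2⟩, hx⟩

variable [CompleteSpace 𝒳]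

lemma inner_apply_left {A : 𝒳 →L[ℂ] 𝒳} (hA : IsSelfAdjoint A) (x y : 𝒳) :
    inner ℂ (A x) y = inner ℂ x (A y) :=
  hA.isSymmetric x y

lemma denseRange_of_isSelfAdjoint {R : 𝒳 →L[ℂ] 𝒳} (hR : IsSelfAdjoint R)
    (hinj : Function.Injective R) : DenseRange R := by
  have h : (R : 𝒳 →ₗ[ℂ] 𝒳).rangeᗮ = ⊥ := by
    have := ContinuousLinearMap.orthogonal_range R
    rw [hR.adjoint_eq] at this
    exact this.trans (LinearMap.ker_eq_bot.2 hinj)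
  exact Submodule.dense_iff_topologicalClosure_eq_top.2
    ((Submodule.topologicalClosure_eq_top_iff (K := (R : 𝒳 →ₗ[ℂ] 𝒳).range)).2 h)

variable {T : 𝒳 →ₗ.[ℂ] 𝒳} {R : 𝒳 →L[ℂ] 𝒳}

lemma HasInverse.isSelfAdjoint (h : HasInverse T R) (hR : IsSelfAdjoint R) : IsSelfAdjoint T := by
  have hd : Dense (T.domain : Set 𝒳) :=
    (denseRange_of_isSelfAdjoint hR h.injective).mono (range_subset_iff.2 h.mem)
  have h' : HasInverse T.adjoint R := by
    intro Z W
    constructor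
    · rintro ⟨hZ, hW⟩
      refine ext_inner_right ℂ fun v => ?_
      have := LinearPMap.adjoint_isFormalAdjoint hd ⟨Z, hZ⟩ ⟨R v, h.mem v⟩
      rwa [h.apply_inverse, hW, ← inner_apply_left hR] at this
    · intro e
      have key : ∀ x : T.domain, inner ℂ W (x : 𝒳) = inner ℂ Z (T x) := fun x => by
        rw [← e, inner_apply_left hR, h.inverse_apply]
      have hZ : Z ∈ T.adjoint.domain := LinearPMap.mem_adjoint_domain_of_exists Z ⟨W, key⟩
      exact ⟨hZ, LinearPMap.adjoint_apply_eq hd ⟨Z, hZ⟩ key⟩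
  exact LinearPMap.isSelfAdjoint_def.2 (h'.ext h)

lemma exists_hasInverse_of_bijective (hT : IsSelfAdjoint T)
    (hbij : Function.Bijective (fun x : T.domain => T x)) :
    ∃ R : 𝒳 →L[ℂ] 𝒳, HasInverse T R ∧ IsSelfAdjoint R := by
  let e := LinearEquiv.ofBijective T.toFun hbij
  let R₀ : 𝒳 →ₗ[ℂ] 𝒳 := T.domain.subtype ∘ₗ (e.symm : 𝒳 →ₗ[ℂ] T.domain)
  have hTR : ∀ W, T (e.symm W) = W := e.apply_symm_apply
  have hsymm : R₀.IsSymmetric := fun x y => by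
    have := LinearPMap.adjoint_isFormalAdjoint hT.dense_domain
    rw [LinearPMap.isSelfAdjoint_def.1 hT] at this
    have h := this (e.symm x) (e.symm y)
    rw [hTR, hTR] at h
    exact h.symm
  -- Hellinger–Toeplitz
  refine ⟨⟨R₀, hsymm.continuous⟩, fun Z W => ⟨?_, ?_⟩, ?_⟩
  · rintro ⟨hZ, rfl⟩
    exact congrArg Subtype.val (e.symm_apply_apply ⟨Z, hZ⟩)
  · rintro rfl
    exact ⟨(e.symm W).2, hTR W⟩
  · exact ContinuousLinearMap.isSelfAdjoint_iff_isSymmetric.2 hsymm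

lemma isUnit_of_isSelfAdjoint_of_mul_eq_one {M : Type*} [Monoid M] [StarMul M] {a b : M}
    (ha : IsSelfAdjoint a) (h : b * a = 1) : IsUnit a := by
  have h' : a * star b = 1 := by rw [← ha.star_eq, ← star_mul, h, star_one]
  exact isUnit_iff_exists.2 ⟨b, left_inv_eq_right_inv h h' ▸ h', h⟩

lemma HasInverse.nonneg (h : HasInverse T R) (hR : IsSelfAdjoint R)
    (hT : ∀ r < (0 : ℝ), (r : ℂ) ∈ resolventSet T) : 0 ≤ R := by
  rw [StarOrderedRing.nonneg_iff_spectrum_nonneg (R := ℝ) R hR]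
  intro s hs
  by_contra! hneg
  obtain ⟨G, -, hG⟩ := hT s⁻¹ (inv_lt_zero.2 hneg)
  have hGR : ∀ V, G V - s⁻¹ • G (R V) = R V := fun V => by
    have := hG ⟨R V, h.mem V⟩
    rwa [h.apply_inverse, map_sub, map_smul, Complex.coe_smul] at this
  refine hs (isUnit_of_isSelfAdjoint_of_mul_eq_one (b := s⁻¹ • (1 + s⁻¹ • G))
    ((IsSelfAdjoint.algebraMap _ (IsSelfAdjoint.all s)).sub hR) ?_)
  ext V
  calc s⁻¹ • ((s • V - R V) + s⁻¹ • G (s • V - R V)) = V := by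
        rw [map_sub, G.map_smul_of_tower, smul_sub s⁻¹ (s • G V), inv_smul_smul₀ hneg.ne, hGR V,
          sub_add_cancel, inv_smul_smul₀ hneg.ne]

lemma HasInverse.exists_isPositiveSqrt (h : HasInverse T R) (hR : 0 ≤ R) :
    ∃ Λ : 𝒳 →ₗ.[ℂ] 𝒳, IsPositiveSqrt Λ T := by
  obtain ⟨S, hS, hSR⟩ : ∃ S : 𝒳 →L[ℂ] 𝒳, 0 ≤ S ∧ S * S = R :=
    ⟨CFC.sqrt R, CFC.sqrt_nonneg R, CFC.sqrt_mul_sqrt_self R hR⟩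
  have hinj : Function.Injective S := fun x y e => h.injective (by
    rw [← hSR]
    exact congrArg S e)
  obtain ⟨Λ, hΛ⟩ := HasInverse.exists_of_injective hinj
  refine ⟨Λ, hΛ.isSelfAdjoint hS.isSelfAdjoint, fun x => ?_, ?_⟩
  · have := ((ContinuousLinearMap.nonneg_iff_isPositive S).1 hS).re_inner_nonneg_right (Λ x)
    rwa [hΛ.inverse_apply] at this
  · exact (hΛ.comp hΛ).ext (hSR ▸ h)

lemma IsPositiveSqrt.exists_hasInverse {Λ : 𝒳 →ₗ.[ℂ] 𝒳} (hΛ : IsPositiveSqrt Λ T)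
    (h : HasInverse T R) : ∃ S, HasInverse Λ S ∧ IsSelfAdjoint S ∧ S * S = R := by
  have hΛΛ : HasInverse (comp Λ Λ) R := hΛ.sq_eq ▸ h
  obtain ⟨S, hS, hSsa⟩ := exists_hasInverse_of_bijective hΛ.selfAdjoint
    (bijective_of_bijective_comp_self hΛΛ.bijective)
  exact ⟨S, hS, hSsa, (hS.comp hS).unique hΛΛ⟩

end BoundedInverse

section StieltjesIntegral

variable {𝒳 : Type*} [NormedAddCommGroup 𝒳] {f : ℝ → ℂ}

lemma exists_partition {a b η : ℝ} (hab : a ≤ b) (hη : 0 < η) :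
    ∃ (n : ℕ) (p : ℕ → ℝ), p 0 = a ∧ p n = b ∧ ∀ i < n, p i ≤ p (i + 1) ∧ p (i + 1) - p i < η := by
  obtain ⟨n, hn⟩ := exists_nat_gt ((b - a) / η)
  have hn0 : (0 : ℝ) < n := (div_nonneg (sub_nonneg.2 hab) hη.le).trans_lt hn
  have hmesh : ∀ i : ℕ, a + ((i + 1 : ℕ) : ℝ) * ((b - a) / n) - (a + i * ((b - a) / n)) =
      (b - a) / n := fun i => by
    push_cast
    ring
  refine ⟨n, fun i => a + i * ((b - a) / n), by simp, by field_simp; ring, fun i _ => ⟨?_, ?_⟩⟩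
  · rw [← sub_nonneg, hmesh]
    exact div_nonneg (sub_nonneg.2 hab) hn0.le
  · rw [hmesh]
    exact (div_lt_comm₀ hη hn0).1 hn

lemma monotoneOn_Iic_of_le_succ {α : Type*} [Preorder α] {n : ℕ} {p : ℕ → α}
    (h : ∀ i < n, p i ≤ p (i + 1)) : MonotoneOn p (Iic n) :=
  monotoneOn_of_le_succ ordConnected_Iic fun i _ _ hi => h i hi

variable [InnerProductSpace ℂ 𝒳] {F : ℝ → 𝒳} {a b : ℝ} {I I' : 𝒳}

lemma HasRSIntegral.exists_sum (h : HasRSIntegral f F a b I) (hab : a ≤ b) {ε η : ℝ} (hε : 0 < ε)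
    (hη : 0 < η) : ∃ (n : ℕ) (p : ℕ → ℝ), p 0 = a ∧ p n = b ∧
      (∀ i < n, p i ≤ p (i + 1) ∧ p (i + 1) - p i < η) ∧
      ‖(∑ i ∈ Finset.range n, f (p i) • (F (p (i + 1)) - F (p i))) - I‖ < ε := by
  obtain ⟨η', hη', h'⟩ := h ε hε
  obtain ⟨n, p, h0, hn, hp⟩ := exists_partition hab (lt_min hη hη')
  exact ⟨n, p, h0, hn, fun i hi => ⟨(hp i hi).1, (hp i hi).2.trans_le (min_le_left _ _)⟩,
    h' n p p h0 hn fun i hi => ⟨left_mem_Icc.2 (hp i hi).1,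
      (hp i hi).2.trans_le (min_le_right _ _)⟩⟩

lemma HasRSIntegral.unique (h : HasRSIntegral f F a b I) (h' : HasRSIntegral f F a b I')
    (hab : a ≤ b) : I = I' := by
  refine eq_of_norm_sub_le_zero (le_of_forall_pos_le_add fun ε hε => ?_)
  obtain ⟨η, hη, hs⟩ := h' (ε / 2) (half_pos hε)
  obtain ⟨n, p, h0, hn, hp, hsum⟩ := h.exists_sum hab (half_pos hε) hη
  have hsum' := hs n p p h0 hn fun i hi => ⟨left_mem_Icc.2 (hp i hi).1, (hp i hi).2⟩
  rw [norm_sub_rev] at hsum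
  have := norm_sub_le_norm_sub_add_norm_sub I
    (∑ i ∈ Finset.range n, f (p i) • (F (p (i + 1)) - F (p i))) I'
  linarith

lemma HasRSIntegral.map (h : HasRSIntegral f F a b I) (L : 𝒳 →L[ℂ] 𝒳) :
    HasRSIntegral f (fun ω => L (F ω)) a b (L I) := by
  intro ε hε
  obtain ⟨η, hη, hs⟩ := h (ε / (‖L‖ + 1)) (by positivity)
  refine ⟨η, hη, fun n p ξ h0 hn hp => ?_⟩
  set S := ∑ i ∈ Finset.range n, f (ξ i) • (F (p (i + 1)) - F (p i))
  calc ‖(∑ i ∈ Finset.range n, f (ξ i) • (L (F (p (i + 1))) - L (F (p i)))) - L I‖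
      = ‖L (S - I)‖ := by simp only [S, map_sub, map_sum, map_smul]
    _ ≤ ‖L‖ * ‖S - I‖ := L.le_opNorm _
    _ ≤ (‖L‖ + 1) * ‖S - I‖ := by gcongr; linarith
    _ < (‖L‖ + 1) * (ε / (‖L‖ + 1)) := by gcongr; exact hs n p ξ h0 hn hp
    _ = ε := by field_simp

lemma HasImproperRSIntegral.map (h : HasImproperRSIntegral f F I) (L : 𝒳 →L[ℂ] 𝒳) :
    HasImproperRSIntegral f (fun ω => L (F ω)) (L I) := by
  obtain ⟨G, hG, hlim⟩ := h
  exact ⟨fun a b => L (G a b), fun a b hab => (hG a b hab).map L,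
    (L.continuous.tendsto I).comp hlim⟩

lemma eventually_Icc_subset (p q : ℝ) :
    ∀ᶠ x : ℝ × ℝ in atBot ×ˢ atTop, x.1 ≤ p ∧ q ≤ x.2 :=
  (eventually_le_atBot p).prod_mk (eventually_ge_atTop q)

lemma HasImproperRSIntegral.unique (h : HasImproperRSIntegral f F I)
    (h' : HasImproperRSIntegral f F I') : I = I' := by
  obtain ⟨G, hG, hlim⟩ := h
  obtain ⟨G', hG', hlim'⟩ := h'
  refine tendsto_nhds_unique hlim (hlim'.congr' ?_)
  filter_upwards [eventually_Icc_subset 0 0] with x hx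
  have hx' := hx.1.trans hx.2
  exact (hG' _ _ hx').unique (hG _ _ hx') hx'

end StieltjesIntegral

section SpectralFamily

variable {𝒳 : Type*} [NormedAddCommGroup 𝒳] [InnerProductSpace ℂ 𝒳]

/-- For a spectral family `E` and `p ≤ q`, the spectral projection of the interval `(p, q]`. -/
def increment (E : ℝ → 𝒳 →L[ℂ] 𝒳) (p q : ℝ) : 𝒳 →L[ℂ] 𝒳 := E q - E p

lemma increment_apply (E : ℝ → 𝒳 →L[ℂ] 𝒳) (p q : ℝ) (z : 𝒳) :
    increment E p q z = E q z - E p z := rfl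

lemma sum_increment (E : ℝ → 𝒳 →L[ℂ] 𝒳) (n : ℕ) (p : ℕ → ℝ) (z : 𝒳) :
    ∑ i ∈ Finset.range n, increment E (p i) (p (i + 1)) z = increment E (p 0) (p n) z :=
  Finset.sum_range_sub (fun i => E (p i) z) n

variable [CompleteSpace 𝒳] {E : ℝ → 𝒳 →L[ℂ] 𝒳}

lemma norm_starProjection_apply_le {P : 𝒳 →L[ℂ] 𝒳} (hP : IsStarProjection P) (z : 𝒳) :
    ‖P z‖ ≤ ‖z‖ :=
  (P.le_of_opNorm_le (IsStarProjection.norm_le P hP) z).trans_eq (one_mul _)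

namespace IsSpectralFamily

lemma apply_apply (hE : IsSpectralFamily E) {ω ω' : ℝ} (h : ω ≤ ω') (z : 𝒳) :
    E ω (E ω' z) = E ω z :=
  DFunLike.congr_fun (hE.monotone ω ω' h) z

lemma apply_apply' (hE : IsSpectralFamily E) {ω ω' : ℝ} (h : ω ≤ ω') (z : 𝒳) :
    E ω' (E ω z) = E ω z := by
  have hsa := fun ω => (hE.projection ω).isSelfAdjoint
  refine ext_inner_right ℂ fun v => ?_
  rw [inner_apply_left (hsa ω'), inner_apply_left (hsa ω), hE.apply_apply h,
    inner_apply_left (hsa ω)]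

lemma comm (hE : IsSpectralFamily E) (ω ω' : ℝ) (z : 𝒳) : E ω (E ω' z) = E ω' (E ω z) := by
  rcases le_total ω ω' with h | h <;> rw [hE.apply_apply h, hE.apply_apply' h]

lemma apply_increment (hE : IsSpectralFamily E) (ω p q : ℝ) (z : 𝒳) :
    E ω (increment E p q z) = increment E p q (E ω z) := by
  simp only [increment_apply, map_sub, hE.comm ω]

lemma increment_comm (hE : IsSpectralFamily E) (s t p q : ℝ) (z : 𝒳) :
    increment E s t (increment E p q z) = increment E p q (increment E s t z) := by
  rw [increment_apply E s t, hE.apply_increment, hE.apply_increment, ← map_sub, ← increment_apply]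

lemma apply_increment_of_le_left (hE : IsSpectralFamily E) {p q ω : ℝ} (hω : ω ≤ p) (hpq : p ≤ q)
    (z : 𝒳) : E ω (increment E p q z) = 0 := by
  rw [increment_apply, map_sub, hE.apply_apply hω, hE.apply_apply (hω.trans hpq), sub_self]

lemma apply_increment_of_le_right (hE : IsSpectralFamily E) {p q ω : ℝ} (hpq : p ≤ q) (hω : q ≤ ω)
    (z : 𝒳) : E ω (increment E p q z) = increment E p q z := by
  rw [increment_apply, map_sub, hE.apply_apply' hω, hE.apply_apply' (hpq.trans hω)]

lemma increment_increment_of_le (hE : IsSpectralFamily E) {s t p q : ℝ} (hst : s ≤ t) (htp : t ≤ p)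
    (hpq : p ≤ q) (z : 𝒳) : increment E s t (increment E p q z) = 0 := by
  rw [increment_apply E s t, hE.apply_increment_of_le_left htp hpq,
    hE.apply_increment_of_le_left (hst.trans htp) hpq, sub_self]

lemma increment_increment_of_subset (hE : IsSpectralFamily E) {a p q b : ℝ} (hap : a ≤ p)
    (hpq : p ≤ q) (hqb : q ≤ b) (z : 𝒳) :
    increment E a b (increment E p q z) = increment E p q z := by
  rw [increment_apply E a b, hE.apply_increment_of_le_left hap hpq,
    hE.apply_increment_of_le_right hpq hqb, sub_zero]

lemma isStarProjection_increment (hE : IsSpectralFamily E) {p q : ℝ} (h : p ≤ q) :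
    IsStarProjection (increment E p q) where
  isIdempotentElem := ContinuousLinearMap.ext (hE.increment_increment_of_subset le_rfl h le_rfl)
  isSelfAdjoint := (hE.projection q).isSelfAdjoint.sub (hE.projection p).isSelfAdjoint

lemma norm_increment_le (hE : IsSpectralFamily E) {p q : ℝ} (h : p ≤ q) (z : 𝒳) :
    ‖increment E p q z‖ ≤ ‖z‖ :=
  norm_starProjection_apply_le (hE.isStarProjection_increment h) z

lemma tendsto_increment (hE : IsSpectralFamily E) (z : 𝒳) :
    Tendsto (fun x : ℝ × ℝ => increment E x.1 x.2 z) (Filter.atBot ×ˢ Filter.atTop) (𝓝 z) := by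
  simpa only [Function.comp_def, sub_zero, increment_apply] using
    ((hE.atTop z).comp tendsto_snd).sub
      ((hE.atBot z).comp (tendsto_fst (g := (Filter.atTop : Filter ℝ))))

lemma norm_sum_increment_sq (hE : IsSpectralFamily E) {n : ℕ} {p : ℕ → ℝ}
    (hp : MonotoneOn p (Iic n)) (y : ℕ → 𝒳) :
    ‖∑ i ∈ Finset.range n, increment E (p i) (p (i + 1)) (y i)‖ ^ 2 =
      ∑ i ∈ Finset.range n, ‖increment E (p i) (p (i + 1)) (y i)‖ ^ 2 := by
  induction n with
  | zero => simp
  | succ n ih =>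
    have hle : ∀ {i j}, i ≤ j → j ≤ n + 1 → p i ≤ p j := fun hij hj => hp (hij.trans hj) hj hij
    have horth : inner ℂ (∑ i ∈ Finset.range n, increment E (p i) (p (i + 1)) (y i))
        (increment E (p n) (p (n + 1)) (y n)) = 0 := by
      rw [sum_inner]
      refine Finset.sum_eq_zero fun i hi => ?_
      have hi := Finset.mem_range.1 hi
      have hii := hle i.le_succ (by omega)
      rw [inner_apply_left (hE.isStarProjection_increment hii).isSelfAdjoint,
        hE.increment_increment_of_le hii (hle hi (by omega)) (hle n.le_succ le_rfl),
        inner_zero_right]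
    rw [Finset.sum_range_succ, Finset.sum_range_succ,
      ← ih (hp.mono (Iic_subset_Iic.2 n.le_succ)), pow_two, pow_two, pow_two]
    exact norm_add_sq_eq_norm_sq_add_norm_sq_of_inner_eq_zero _ _ horth

lemma norm_sum_increment_le (hE : IsSpectralFamily E) {n : ℕ} {p : ℕ → ℝ}
    (hp : MonotoneOn p (Iic n)) {y : ℕ → 𝒳} {C : ℝ} (hC : 0 ≤ C) {z : 𝒳}
    (hy : ∀ i < n, ‖increment E (p i) (p (i + 1)) (y i)‖ ≤
      C * ‖increment E (p i) (p (i + 1)) z‖) :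
    ‖∑ i ∈ Finset.range n, increment E (p i) (p (i + 1)) (y i)‖ ≤
      C * ‖increment E (p 0) (p n) z‖ := by
  refine le_of_sq_le_sq ?_ (by positivity)
  rw [hE.norm_sum_increment_sq hp, mul_pow, ← sum_increment, hE.norm_sum_increment_sq hp,
    Finset.mul_sum]
  refine Finset.sum_le_sum fun i hi => ?_
  rw [← mul_pow]
  exact pow_le_pow_left₀ (norm_nonneg _) (hy i (Finset.mem_range.1 hi)) 2

lemma hasRSIntegral_of_norm_sub_le (hE : IsSpectralFamily E) {f : ℝ → ℂ} {z V : 𝒳} {C : ℝ}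
    (h : ∀ {p c q : ℝ}, p ≤ c → c ≤ q →
      ‖f c • increment E p q z - increment E p q V‖ ≤ C * (q - p) * ‖increment E p q z‖)
    (a b : ℝ) : HasRSIntegral f (fun ω => E ω z) a b (increment E a b V) := by
  intro ε hε
  have hη : 0 < ε / (|C| * ‖z‖ + 1) := by positivity
  refine ⟨_, hη, fun n p ξ h0 hn hp => ?_⟩
  have hmono := monotoneOn_Iic_of_le_succ fun i hi => (hp i hi).1.1.trans (hp i hi).1.2
  have hab : p 0 ≤ p n := hmono n.zero_le self_mem_Iic n.zero_le
  set η := ε / (|C| * ‖z‖ + 1)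
  have hcell : ∀ i < n, ‖increment E (p i) (p (i + 1)) (f (ξ i) • z - V)‖ ≤
      |C| * η * ‖increment E (p i) (p (i + 1)) z‖ := fun i hi => by
    have := sub_nonneg.2 ((hp i hi).1.1.trans (hp i hi).1.2)
    rw [map_sub, map_smul]
    refine (h (hp i hi).1.1 (hp i hi).1.2).trans ?_
    gcongr
    exacts [le_abs_self C, (hp i hi).2.le]
  calc ‖(∑ i ∈ Finset.range n, f (ξ i) • increment E (p i) (p (i + 1)) z) - increment E a b V‖
      = ‖∑ i ∈ Finset.range n, increment E (p i) (p (i + 1)) (f (ξ i) • z - V)‖ := by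
        simp only [map_sub, map_smul, Finset.sum_sub_distrib, sum_increment, h0, hn]
    _ ≤ |C| * η * ‖increment E (p 0) (p n) z‖ :=
        hE.norm_sum_increment_le hmono (by positivity) hcell
    _ ≤ |C| * η * ‖z‖ := by gcongr; exact hE.norm_increment_le hab z
    _ < (|C| * ‖z‖ + 1) * η := by linarith
    _ = ε := by simp only [η]; field_simp

lemma hasImproperRSIntegral_of_norm_sub_le (hE : IsSpectralFamily E) {f : ℝ → ℂ} {z V : 𝒳} {C : ℝ}
    (h : ∀ {p c q : ℝ}, p ≤ c → c ≤ q →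
      ‖f c • increment E p q z - increment E p q V‖ ≤ C * (q - p) * ‖increment E p q z‖) :
    HasImproperRSIntegral f (fun ω => E ω z) V :=
  ⟨fun a b => increment E a b V, fun a b _ => hE.hasRSIntegral_of_norm_sub_le h a b,
    hE.tendsto_increment V⟩

lemma norm_sub_smul_increment_le (hE : IsSpectralFamily E) {p c q t t' : ℝ} (hpc : p ≤ c)
    (hcq : c ≤ q) (ht : t ≤ t') {x : 𝒳} (hx : increment E p q x = x) :
    ‖((t : ℂ) - c) • increment E t t' x‖ ≤ (q - p + (t' - t)) * ‖increment E t t' x‖ := by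
  have hpq := hpc.trans hcq
  by_cases hout : t' ≤ p ∨ q ≤ t
  · have h0 : increment E t t' x = 0 := by
      rw [← hx]
      rcases hout with h | h
      · exact hE.increment_increment_of_le ht h hpq x
      · rw [hE.increment_comm, hE.increment_increment_of_le hpq h ht]
    rw [h0, smul_zero, norm_zero, mul_zero]
  · push Not at hout
    rw [norm_smul, ← Complex.ofReal_sub, Complex.norm_real, Real.norm_eq_abs]
    gcongr
    rw [abs_le]
    constructor <;> linarith

lemma norm_sub_smul_le_of_hasRSIntegral (hE : IsSpectralFamily E) {a p c q b : ℝ} (hap : a ≤ p)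
    (hpc : p ≤ c) (hcq : c ≤ q) (hqb : q ≤ b) {x I : 𝒳} (hx : increment E p q x = x)
    (hI : HasRSIntegral (fun ω => (ω : ℂ)) (fun ω => E ω x) a b I) :
    ‖I - (c : ℂ) • x‖ ≤ (q - p) * ‖x‖ := by
  have hpq := hpc.trans hcq
  have hx' : increment E a b x = x := by
    rw [← hx, hE.increment_increment_of_subset hap hpq hqb]
  have hbound : ∀ ε > 0, ‖I - (c : ℂ) • x‖ ≤ ε + (q - p + ε) * ‖x‖ := fun ε hε => by
    obtain ⟨n, t, h0, hn, ht, hsum⟩ := hI.exists_sum (hap.trans (hpq.trans hqb)) hε hε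
    set S := ∑ i ∈ Finset.range n, (t i : ℂ) • (E (t (i + 1)) x - E (t i) x) with hS
    have hSc : S - (c : ℂ) • x =
        ∑ i ∈ Finset.range n, increment E (t i) (t (i + 1)) (((t i : ℂ) - c) • x) := by
      conv_lhs => rw [← hx', ← hn, ← h0, ← sum_increment, Finset.smul_sum, hS,
        ← Finset.sum_sub_distrib]
      simp only [← sub_smul, map_smul, ← increment_apply]
    have hle : ‖S - (c : ℂ) • x‖ ≤ (q - p + ε) * ‖x‖ := by
      conv_rhs => rw [← hx', ← h0, ← hn]
      rw [hSc]
      refine hE.norm_sum_increment_le (monotoneOn_Iic_of_le_succ fun i hi => (ht i hi).1)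
        (by linarith) fun i hi => ?_
      rw [map_smul]
      refine (hE.norm_sub_smul_increment_le hpc hcq (ht i hi).1 hx).trans ?_
      gcongr
      exact (ht i hi).2.le
    rw [norm_sub_rev] at hsum
    linarith [norm_sub_le_norm_sub_add_norm_sub I S ((c : ℂ) • x)]
  have hlim : Tendsto (fun ε : ℝ => ε + (q - p + ε) * ‖x‖) (𝓝[>] 0) (𝓝 ((q - p) * ‖x‖)) := by
    have : Continuous fun ε : ℝ => ε + (q - p + ε) * ‖x‖ := by fun_prop
    simpa only [zero_add, add_zero] using (this.tendsto 0).mono_left nhdsWithin_le_nhds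
  exact ge_of_tendsto hlim (eventually_mem_nhdsWithin.mono hbound)

end IsSpectralFamily

end SpectralFamily

section CfcApply

variable {𝒳 : Type*} [NormedAddCommGroup 𝒳] [InnerProductSpace ℂ 𝒳] [CompleteSpace 𝒳]
  {K : 𝒳 →L[ℂ] 𝒳} {f g : ℝ → ℝ}

lemma cfc_apply_cfc (hf : Continuous f) (hg : Continuous g) (z : 𝒳) :
    cfc f K (cfc g K z) = cfc (fun κ => f κ * g κ) K z :=
  (DFunLike.congr_fun (cfc_mul f g K hf.continuousOn hg.continuousOn) z).symm

lemma cfc_sub_apply (hf : Continuous f) (hg : Continuous g) (z : 𝒳) :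
    cfc (fun κ => f κ - g κ) K z = cfc f K z - cfc g K z :=
  DFunLike.congr_fun (cfc_sub f g K hf.continuousOn hg.continuousOn) z

lemma isSelfAdjoint_cfc : IsSelfAdjoint (cfc f K) := cfc_predicate f K

lemma re_inner_cfc_nonneg (h : ∀ κ, 0 ≤ f κ) (z : 𝒳) : 0 ≤ (inner ℂ (cfc f K z) z).re :=
  ((ContinuousLinearMap.nonneg_iff_isPositive (cfc f K)).1
    (cfc_nonneg fun κ _ => h κ)).re_inner_nonneg_left z

lemma norm_cfc_apply_le (hf : Continuous f) (hg : Continuous g) (h : ∀ κ, |f κ| ≤ |g κ|)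
    (z : 𝒳) : ‖cfc f K z‖ ≤ ‖cfc g K z‖ := by
  have hsq : ∀ {φ : ℝ → ℝ}, Continuous φ →
      (inner ℂ (cfc (fun κ => φ κ * φ κ) K z) z).re = ‖cfc φ K z‖ ^ 2 := fun hφ => by
    rw [← cfc_apply_cfc hφ hφ, inner_apply_left isSelfAdjoint_cfc]
    exact inner_self_eq_norm_sq (𝕜 := ℂ) _
  have hnonneg := re_inner_cfc_nonneg (K := K) (f := fun κ => g κ * g κ - f κ * f κ)
    (fun κ => sub_nonneg.2 (abs_le_iff_mul_self_le.1 (h κ))) z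
  rw [cfc_sub_apply (by fun_prop) (by fun_prop), inner_sub_left, Complex.sub_re, hsq hg, hsq hf,
    sub_nonneg] at hnonneg
  exact le_of_sq_le_sq hnonneg (norm_nonneg _)

lemma starProjection_apply_comm {A : 𝒳 →L[ℂ] 𝒳} (hA : IsSelfAdjoint A) (U : Submodule ℂ 𝒳)
    [U.HasOrthogonalProjection] (h : ∀ u ∈ U, A u ∈ U) (z : 𝒳) :
    A (U.starProjection z) = U.starProjection (A z) := by
  refine (U.eq_starProjection_of_mem_of_inner_eq_zero
    (h _ (U.starProjection_apply_mem z)) fun w hw => ?_).symm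
  rw [← map_sub, inner_apply_left hA]
  exact U.starProjection_inner_eq_zero z _ (h w hw)

end CfcApply

section SpectralProjection

/-- The positive part of `κ - ω κ²`; for `κ ≠ 0` it vanishes if and only if `κ⁻¹ ≤ ω`. -/
def upperCut (ω κ : ℝ) : ℝ := max (κ - ω * κ ^ 2) 0

/-- The negative part of `κ - ω κ²`; for `κ ≠ 0` it vanishes if and only if `ω ≤ κ⁻¹`. -/
def lowerCut (ω κ : ℝ) : ℝ := max (-(κ - ω * κ ^ 2)) 0

@[fun_prop]
lemma continuous_upperCut (ω : ℝ) : Continuous (upperCut ω) := by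
  unfold upperCut
  fun_prop

@[fun_prop]
lemma continuous_lowerCut (ω : ℝ) : Continuous (lowerCut ω) := by
  unfold lowerCut
  fun_prop

lemma upperCut_nonneg (ω κ : ℝ) : 0 ≤ upperCut ω κ := le_max_right _ _

lemma lowerCut_nonneg (ω κ : ℝ) : 0 ≤ lowerCut ω κ := le_max_right _ _

lemma upperCut_sub_lowerCut (ω κ : ℝ) : upperCut ω κ - lowerCut ω κ = κ - ω * κ ^ 2 :=
  max_zero_sub_max_neg_zero_eq_self _

lemma upperCut_mul_lowerCut (ω κ : ℝ) : upperCut ω κ * lowerCut ω κ = 0 := by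
  rcases le_total (κ - ω * κ ^ 2) 0 with h | h
  · rw [upperCut, max_eq_right h, zero_mul]
  · rw [lowerCut, max_eq_right (neg_nonpos.2 h), mul_zero]

lemma abs_upperCut_le {ω ω' : ℝ} (h : ω ≤ ω') (κ : ℝ) : |upperCut ω' κ| ≤ |upperCut ω κ| := by
  rw [abs_of_nonneg (upperCut_nonneg _ _), abs_of_nonneg (upperCut_nonneg _ _)]
  unfold upperCut
  gcongr

lemma abs_upperCut_sub_le (ω ω' κ : ℝ) :
    |upperCut ω κ - upperCut ω' κ| ≤ |(ω' - ω) * (κ * κ)| := by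
  refine (abs_max_sub_max_le_abs _ _ _).trans_eq (congrArg _ ?_)
  ring

variable {𝒳 : Type*} [NormedAddCommGroup 𝒳] [InnerProductSpace ℂ 𝒳]

lemma tendsto_zero_of_mem_closure {ι : Type*} {l : Filter ι} {A : ι → 𝒳 →L[ℂ] 𝒳}
    (hA : ∀ i z, ‖A i z‖ ≤ ‖z‖) {S : Set 𝒳}
    (hS : ∀ u ∈ S, Tendsto (fun i => A i u) l (𝓝 0)) {z : 𝒳} (hz : z ∈ closure S) :
    Tendsto (fun i => A i z) l (𝓝 0) := by
  rw [Metric.tendsto_nhds]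
  intro ε hε
  obtain ⟨u, hu, hd⟩ := Metric.mem_closure_iff.1 hz (ε / 2) (half_pos hε)
  filter_upwards [Metric.tendsto_nhds.1 (hS u hu) (ε / 2) (half_pos hε)] with i hi
  rw [dist_zero_right] at hi ⊢
  rw [dist_eq_norm] at hd
  calc ‖A i z‖ = ‖A i (z - u) + A i u‖ := by rw [map_sub, sub_add_cancel]
    _ ≤ ‖z - u‖ + ‖A i u‖ := (norm_add_le _ _).trans (by gcongr; exact hA _ _)
    _ < ε := by linarith

variable [CompleteSpace 𝒳]

/-- For selfadjoint injective `K`, the spectral projection of the operator `K⁻¹` that belongs to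
`(-∞, ω]`. -/
def spectralProj (K : 𝒳 →L[ℂ] 𝒳) (ω : ℝ) : 𝒳 →L[ℂ] 𝒳 :=
  (cfc (upperCut ω) K).ker.starProjection

variable {K : 𝒳 →L[ℂ] 𝒳}

lemma isStarProjection_spectralProj (ω : ℝ) : IsStarProjection (spectralProj K ω) :=
  isStarProjection_starProjection

lemma norm_spectralProj_le (ω : ℝ) (z : 𝒳) : ‖spectralProj K ω z‖ ≤ ‖z‖ :=
  norm_starProjection_apply_le (isStarProjection_spectralProj ω) z

lemma norm_sub_spectralProj_le (ω : ℝ) (z : 𝒳) : ‖z - spectralProj K ω z‖ ≤ ‖z‖ :=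
  norm_starProjection_apply_le (isStarProjection_spectralProj (K := K) ω).one_sub z

lemma upperCut_spectralProj {ω ω' : ℝ} (h : ω ≤ ω') (z : 𝒳) :
    cfc (upperCut ω') K (spectralProj K ω z) = 0 := by
  have hω : cfc (upperCut ω) K (spectralProj K ω z) = 0 :=
    Submodule.starProjection_apply_mem (cfc (upperCut ω) K).ker z
  simpa only [hω, norm_zero, norm_le_zero_iff] using norm_cfc_apply_le (K := K)
    (continuous_upperCut ω') (continuous_upperCut ω) (abs_upperCut_le h) (spectralProj K ω z)

lemma spectralProj_of_upperCut {ω : ℝ} {z : 𝒳} (h : cfc (upperCut ω) K z = 0) :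
    spectralProj K ω z = z :=
  Submodule.starProjection_eq_self_iff.2 h

lemma cfc_spectralProj (f : ℝ → ℝ) (ω : ℝ) (z : 𝒳) :
    cfc f K (spectralProj K ω z) = spectralProj K ω (cfc f K z) := by
  refine starProjection_apply_comm isSelfAdjoint_cfc _ (fun u hu => ?_) z
  have hu : cfc (upperCut ω) K u = 0 := hu
  have hcomm := DFunLike.congr_fun (cfc_commute_cfc (upperCut ω) f K).eq u
  exact hcomm.trans (by rw [mul_apply_eq_comp, hu, map_zero])

lemma apply_spectralProj (hK : IsSelfAdjoint K) (ω : ℝ) (z : 𝒳) :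
    K (spectralProj K ω z) = spectralProj K ω (K z) := by
  simpa only [cfc_id' ℝ K hK] using cfc_spectralProj (K := K) (fun κ => κ) ω z

lemma spectralProj_spectralProj {ω ω' : ℝ} (h : ω ≤ ω') (z : 𝒳) :
    spectralProj K ω' (spectralProj K ω z) = spectralProj K ω z :=
  spectralProj_of_upperCut (upperCut_spectralProj h z)

lemma spectralProj_spectralProj' {ω ω' : ℝ} (h : ω ≤ ω') (z : 𝒳) :
    spectralProj K ω (spectralProj K ω' z) = spectralProj K ω z := by
  have hsa := fun ω => (isStarProjection_spectralProj (K := K) ω).isSelfAdjoint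
  refine ext_inner_right ℂ fun v => ?_
  rw [inner_apply_left (hsa ω), inner_apply_left (hsa ω'), spectralProj_spectralProj h,
    inner_apply_left (hsa ω)]

lemma lowerCut_sub_spectralProj (ω : ℝ) (z : 𝒳) :
    cfc (lowerCut ω) K (z - spectralProj K ω z) = 0 := by
  have hzero : cfc (upperCut ω) K (cfc (lowerCut ω) K z) = 0 := by
    rw [cfc_apply_cfc (continuous_upperCut ω) (continuous_lowerCut ω)]
    simp only [upperCut_mul_lowerCut]
    rw [cfc_const_zero]
    rfl
  rw [map_sub, cfc_spectralProj, spectralProj_of_upperCut hzero, sub_self]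

lemma upperCut_sub_lowerCut_apply (hK : IsSelfAdjoint K) (ω : ℝ) (z : 𝒳) :
    cfc (upperCut ω) K z - cfc (lowerCut ω) K z = K z - (ω : ℂ) • K (K z) := by
  rw [← cfc_sub_apply (continuous_upperCut ω) (continuous_lowerCut ω)]
  simp only [upperCut_sub_lowerCut]
  rw [cfc_sub_apply (by fun_prop) (by fun_prop), cfc_id' ℝ K hK,
    cfc_const_mul ω (fun κ => κ ^ 2) K, cfc_pow_id K 2 hK, pow_two, Complex.coe_smul]
  rfl

lemma re_inner_apply_sub_smul (hK : IsSelfAdjoint K) (ω : ℝ) (z : 𝒳) :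
    (inner ℂ (K z - (ω : ℂ) • K (K z)) z).re = (inner ℂ (K z) z).re - ω * ‖K z‖ ^ 2 := by
  rw [inner_sub_left, inner_smul_left, Complex.conj_ofReal, inner_apply_left hK (K z),
    Complex.sub_re, Complex.re_ofReal_mul]
  exact congrArg (fun r => _ - ω * r) (inner_self_eq_norm_sq (𝕜 := ℂ) (K z))

lemma mul_le_of_mul_sq_le {c x y : ℝ} (hx : 0 ≤ x) (hy : 0 ≤ y) (h : c * x ^ 2 ≤ x * y) :
    c * x ≤ y := by
  rcases hx.eq_or_lt with rfl | hx
  · rwa [mul_zero]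
  · nlinarith

lemma mul_norm_apply_le_of_lowerCut (hK : IsSelfAdjoint K) {ω : ℝ} {z : 𝒳}
    (hz : cfc (lowerCut ω) K z = 0) : ω * ‖K z‖ ≤ ‖z‖ := by
  refine mul_le_of_mul_sq_le (norm_nonneg _) (norm_nonneg _) ?_
  have hpos := re_inner_cfc_nonneg (K := K) (upperCut_nonneg ω) z
  rw [← sub_zero (cfc (upperCut ω) K z), ← hz, upperCut_sub_lowerCut_apply hK,
    re_inner_apply_sub_smul hK] at hpos
  have hle : (inner ℂ (K z) z).re ≤ ‖K z‖ * ‖z‖ := re_inner_le_norm (𝕜 := ℂ) _ _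
  linarith

lemma neg_mul_norm_apply_le_of_upperCut (hK : IsSelfAdjoint K) {ω : ℝ} {z : 𝒳}
    (hz : cfc (upperCut ω) K z = 0) : -ω * ‖K z‖ ≤ ‖z‖ := by
  refine mul_le_of_mul_sq_le (norm_nonneg _) (norm_nonneg _) ?_
  have hpos := re_inner_cfc_nonneg (K := K) (lowerCut_nonneg ω) z
  rw [← sub_sub_cancel (cfc (upperCut ω) K z) (cfc (lowerCut ω) K z), hz, zero_sub, ← hz,
    upperCut_sub_lowerCut_apply hK, inner_neg_left, Complex.neg_re,
    re_inner_apply_sub_smul hK] at hpos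
  have hle : -(inner ℂ (K z) z).re ≤ ‖K z‖ * ‖z‖ :=
    (neg_le_abs _).trans ((Complex.abs_re_le_norm _).trans (norm_inner_le_norm _ _))
  linarith

lemma norm_spectralProj_upperCut_le (hK : IsSelfAdjoint K) (ω s : ℝ) (u : 𝒳) :
    ‖spectralProj K s (cfc (upperCut ω) K u)‖ ≤ |s - ω| * ‖K (K u)‖ := by
  have hs : spectralProj K s (cfc (upperCut s) K u) = 0 := by
    rw [← cfc_spectralProj, upperCut_spectralProj le_rfl]
  calc ‖spectralProj K s (cfc (upperCut ω) K u)‖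
      = ‖spectralProj K s (cfc (fun κ => upperCut ω κ - upperCut s κ) K u)‖ := by
        rw [cfc_sub_apply (continuous_upperCut ω) (continuous_upperCut s), map_sub, hs, sub_zero]
    _ ≤ ‖cfc (fun κ => upperCut ω κ - upperCut s κ) K u‖ := norm_spectralProj_le s _
    _ ≤ ‖cfc (fun κ => (s - ω) * (κ * κ)) K u‖ :=
        norm_cfc_apply_le (by fun_prop) (by fun_prop) (abs_upperCut_sub_le ω s) u
    _ = |s - ω| * ‖K (K u)‖ := by
        rw [cfc_const_mul (s - ω) (fun κ => κ * κ) K, cfc_mul (fun κ => κ) (fun κ => κ) K,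
          cfc_id' ℝ K hK, smul_apply, norm_smul, Real.norm_eq_abs, mul_apply_eq_comp]

lemma tendsto_spectralProj_sub (hK : IsSelfAdjoint K) (ω : ℝ) (z : 𝒳) :
    Tendsto (fun s => spectralProj K s (z - spectralProj K ω z)) (𝓝[>] ω) (𝓝 0) := by
  have hmem : z - spectralProj K ω z ∈ closure (range (cfc (upperCut ω) K : 𝒳 →L[ℂ] 𝒳)) := by
    have horth : z - spectralProj K ω z ∈ (cfc (upperCut ω) K).kerᗮ :=
      Submodule.sub_starProjection_mem_orthogonal z
    rwa [ContinuousLinearMap.orthogonal_ker, isSelfAdjoint_cfc.adjoint_eq] at horth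
  refine tendsto_zero_of_mem_closure norm_spectralProj_le ?_ hmem
  rintro _ ⟨u, rfl⟩
  refine squeeze_zero_norm (norm_spectralProj_upperCut_le hK ω · u) ?_
  have hcont : Continuous fun s => |s - ω| * ‖K (K u)‖ := by fun_prop
  simpa only [sub_self, abs_zero, zero_mul] using (hcont.tendsto ω).mono_left nhdsWithin_le_nhds

lemma tendsto_spectralProj_atBot (hK : IsSelfAdjoint K) (hinj : Function.Injective K) (z : 𝒳) :
    Tendsto (fun ω => spectralProj K ω z) atBot (𝓝 0) := by
  refine tendsto_zero_of_mem_closure norm_spectralProj_le ?_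
    (denseRange_of_isSelfAdjoint hK hinj z)
  rintro _ ⟨u, rfl⟩
  refine squeeze_zero_norm' (a := fun ω => ‖u‖ / -ω) ?_
    (tendsto_neg_atBot_atTop.const_div_atTop _)
  filter_upwards [eventually_lt_atBot 0] with ω hω
  rw [← apply_spectralProj hK, le_div_iff₀' (neg_pos.2 hω)]
  exact (neg_mul_norm_apply_le_of_upperCut hK (upperCut_spectralProj le_rfl u)).trans
    (norm_spectralProj_le ω u)

lemma tendsto_spectralProj_atTop (hK : IsSelfAdjoint K) (hinj : Function.Injective K) (z : 𝒳) :
    Tendsto (fun ω => spectralProj K ω z) atTop (𝓝 z) := by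
  have h : Tendsto (fun ω => (1 - spectralProj K ω) z) atTop (𝓝 0) := by
    refine tendsto_zero_of_mem_closure norm_sub_spectralProj_le ?_
      (denseRange_of_isSelfAdjoint hK hinj z)
    rintro _ ⟨u, rfl⟩
    refine squeeze_zero_norm' (a := fun ω => ‖u‖ / ω) ?_ (tendsto_id.const_div_atTop _)
    filter_upwards [eventually_gt_atTop 0] with ω hω
    rw [sub_apply, one_apply_eq_self, ← apply_spectralProj hK, ← map_sub, le_div_iff₀' hω]
    exact (mul_norm_apply_le_of_lowerCut hK (lowerCut_sub_spectralProj ω u)).trans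
      (norm_sub_spectralProj_le ω u)
  simpa only [sub_apply, one_apply_eq_self, sub_sub_cancel, sub_zero] using h.const_sub z

lemma isSpectralFamily_spectralProj (hK : IsSelfAdjoint K) (hinj : Function.Injective K) :
    IsSpectralFamily (spectralProj K) where
  projection := isStarProjection_spectralProj
  monotone _ _ h := ContinuousLinearMap.ext (spectralProj_spectralProj' h)
  rightContinuous ω z := by
    have h := (tendsto_spectralProj_sub hK ω z).add_const (spectralProj K ω z)
    rw [zero_add] at h
    refine h.congr' ?_
    filter_upwards [self_mem_nhdsWithin] with s hs
    rw [map_sub, spectralProj_spectralProj (le_of_lt hs), sub_add_cancel]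
  atBot := tendsto_spectralProj_atBot hK hinj
  atTop := tendsto_spectralProj_atTop hK hinj

end SpectralProjection

section Localizes

variable {𝒳 : Type*} [NormedAddCommGroup 𝒳] [InnerProductSpace ℂ 𝒳]

lemma norm_smul_sub_le_of_re_inner {v z : 𝒳} {p c q : ℝ} (hp : p ≤ c) (hq : c ≤ q)
    (h : (inner ℂ (v - (p : ℂ) • z) (v - (q : ℂ) • z)).re ≤ 0) :
    ‖(c : ℂ) • z - v‖ ≤ (q - p) * ‖z‖ := by
  -- `v` lies in the ball with diameter from `p • z` to `q • z`.
  have hball : ‖(v - (p : ℂ) • z) + (v - (q : ℂ) • z)‖ ≤ (q - p) * ‖z‖ := by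
    have hdiam : ‖(v - (p : ℂ) • z) - (v - (q : ℂ) • z)‖ = (q - p) * ‖z‖ := by
      rw [sub_sub_sub_cancel_left, ← sub_smul, ← Complex.ofReal_sub, norm_smul, Complex.norm_real,
        Real.norm_of_nonneg (by linarith)]
    have hpolar := re_inner_eq_norm_add_mul_self_sub_norm_sub_mul_self_div_four (𝕜 := ℂ)
      (v - (p : ℂ) • z) (v - (q : ℂ) • z)
    rw [RCLike.re_eq_complex_re] at hpolar
    rw [← hdiam]
    exact abs_le_of_sq_le_sq' (by nlinarith) (norm_nonneg _) |>.2
  have hcenter : ‖((p + q - 2 * c : ℝ) : ℂ) • z‖ ≤ (q - p) * ‖z‖ := by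
    rw [norm_smul, Complex.norm_real, Real.norm_eq_abs]
    gcongr
    rw [abs_le]
    constructor <;> linarith
  have hsplit : (2 : ℂ) • ((c : ℂ) • z - v) = -((v - (p : ℂ) • z) + (v - (q : ℂ) • z)) -
      ((p + q - 2 * c : ℝ) : ℂ) • z := by
    push_cast
    module
  have htwo : 2 * ‖(c : ℂ) • z - v‖ ≤ 2 * ((q - p) * ‖z‖) := by
    calc 2 * ‖(c : ℂ) • z - v‖ = ‖(2 : ℂ) • ((c : ℂ) • z - v)‖ := by
          rw [norm_smul, Complex.norm_ofNat]
      _ ≤ 2 * ((q - p) * ‖z‖) := by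
          rw [hsplit]
          refine (norm_sub_le _ _).trans ?_
          rw [norm_neg]
          linarith
  linarith

variable [CompleteSpace 𝒳]

/-- The spectral family `E` commutes with `K`, and on the range of its increment over `(p, q]` the
inverse of `K` differs from any `c ∈ [p, q]` by at most `q - p`. The bound is tested on the vectors
`K z`, which the inverse maps to `z`. -/
structure Localizes (E : ℝ → 𝒳 →L[ℂ] 𝒳) (K : 𝒳 →L[ℂ] 𝒳) : Prop extends IsSpectralFamily E where
  apply_comm : ∀ ω z, K (E ω z) = E ω (K z)
  norm_smul_sub_le : ∀ {p c q : ℝ}, p ≤ c → c ≤ q → ∀ z,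
    ‖(c : ℂ) • increment E p q (K z) - increment E p q z‖ ≤ (q - p) * ‖increment E p q (K z)‖

variable {E : ℝ → 𝒳 →L[ℂ] 𝒳} {K : 𝒳 →L[ℂ] 𝒳}

lemma Localizes.apply_increment (h : Localizes E K) (p q : ℝ) (z : 𝒳) :
    K (increment E p q z) = increment E p q (K z) := by
  simp only [increment_apply, map_sub, h.apply_comm]

lemma re_inner_cut_le (hK : IsSelfAdjoint K) {p q : ℝ} {z : 𝒳}
    (hp : cfc (lowerCut p) K z = 0) (hq : cfc (upperCut q) K z = 0) :
    (inner ℂ (K z - (p : ℂ) • K (K z)) (K z - (q : ℂ) • K (K z))).re ≤ 0 := by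
  rw [← upperCut_sub_lowerCut_apply hK, ← upperCut_sub_lowerCut_apply hK, hp, hq, sub_zero,
    zero_sub, inner_neg_right, ← inner_apply_left isSelfAdjoint_cfc,
    cfc_apply_cfc (continuous_lowerCut q) (continuous_upperCut p), Complex.neg_re]
  exact neg_nonpos.2 (re_inner_cfc_nonneg
    (fun κ => mul_nonneg (lowerCut_nonneg q κ) (upperCut_nonneg p κ)) z)

lemma localizes_spectralProj (hK : IsSelfAdjoint K) (hinj : Function.Injective K) :
    Localizes (spectralProj K) K where
  toIsSpectralFamily := isSpectralFamily_spectralProj hK hinj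
  apply_comm := apply_spectralProj hK
  norm_smul_sub_le {p c q} hpc hcq z := by
    have hpq := hpc.trans hcq
    have hcomm : ∀ w, K (increment (spectralProj K) p q w) = increment (spectralProj K) p q (K w) :=
      fun w => by simp only [increment_apply, map_sub, apply_spectralProj hK]
    refine (denseRange_of_isSelfAdjoint hK hinj).induction_on z
      (isClosed_le (by fun_prop) (by fun_prop)) fun w => ?_
    have hlower : cfc (lowerCut p) K (increment (spectralProj K) p q w) = 0 := by
      rw [increment_apply, ← spectralProj_spectralProj' hpq, lowerCut_sub_spectralProj]
    have hupper : cfc (upperCut q) K (increment (spectralProj K) p q w) = 0 := by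
      rw [increment_apply, map_sub, upperCut_spectralProj le_rfl, upperCut_spectralProj hpq,
        sub_zero]
    have hre := re_inner_cut_le hK hlower hupper
    rw [hcomm, hcomm] at hre
    exact norm_smul_sub_le_of_re_inner hpc hcq hre

variable {H : 𝒳 →ₗ.[ℂ] 𝒳}

lemma Localizes.isSpectralResolution (hE : Localizes E K) (h : HasInverse H K) :
    IsSpectralResolution E H where
  family := hE.toIsSpectralFamily
  integral Z W := by
    have himp : ∀ W, HasImproperRSIntegral (fun ω => (ω : ℂ)) (fun ω => E ω (K W)) W := fun W =>
      hE.hasImproperRSIntegral_of_norm_sub_le (C := 1) fun hpc hcq => by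
        rw [one_mul]
        exact hE.norm_smul_sub_le hpc hcq W
    refine (h Z W).trans ⟨?_, fun hW => ?_⟩
    · rintro rfl
      exact himp W
    · have hKZ := hW.map K
      simp only [hE.apply_comm] at hKZ
      exact hKZ.unique (himp Z)

lemma IsSpectralResolution.localizes (hE : IsSpectralResolution E H) (h : HasInverse H K) :
    Localizes E K where
  toIsSpectralFamily := hE.family
  apply_comm ω z := by
    have hcomm : (fun ω' => E ω' (E ω (K z))) = fun ω' => E ω (E ω' (K z)) :=
      funext fun ω' => hE.family.comm ω' ω (K z)
    rw [← h, hE.integral, hcomm]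
    exact ((hE.integral (K z) z).1 ((h _ _).2 rfl)).map (E ω)
  norm_smul_sub_le {p c q} hpc hcq z := by
    have hpq := hpc.trans hcq
    obtain ⟨G, hG, hlim⟩ := ((hE.integral (K z) z).1 ((h _ _).2 rfl)).map (increment E p q)
    have hbound : ∀ᶠ x : ℝ × ℝ in atBot ×ˢ atTop, ‖(c : ℂ) • increment E p q (K z) - G x.1 x.2‖ ≤
        (q - p) * ‖increment E p q (K z)‖ := by
      filter_upwards [eventually_Icc_subset p q] with x hx
      have hI := hG x.1 x.2 (hx.1.trans (hpq.trans hx.2))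
      simp only [← hE.family.apply_increment] at hI
      rw [norm_sub_rev]
      exact hE.family.norm_sub_smul_le_of_hasRSIntegral hx.1 hpc hcq hx.2
        (hE.family.increment_increment_of_subset le_rfl hpq le_rfl _) hI
    exact le_of_tendsto (tendsto_const_nhds.sub hlim).norm hbound

end Localizes

section TruncatedInverse

variable {𝒳 : Type*} [NormedAddCommGroup 𝒳] [InnerProductSpace ℂ 𝒳] [CompleteSpace 𝒳]
  {E : ℝ → 𝒳 →L[ℂ] 𝒳} {K P T : 𝒳 →L[ℂ] 𝒳}

/-- `T` is the inverse of `K` on the range of the projection `P`, which commutes with `K`, and `T`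
vanishes on the kernel of `P`. -/
structure IsTruncatedInverse (K P T : 𝒳 →L[ℂ] 𝒳) : Prop where
  selfAdjoint : IsSelfAdjoint T
  map_apply : ∀ z, K (T z) = P z
  apply_map : ∀ z, T (K z) = P z
  proj_apply : ∀ z, P (T z) = T z

lemma IsTruncatedInverse.apply_proj (hT : IsTruncatedInverse K P T) (z : 𝒳) : T (P z) = T z := by
  rw [← hT.map_apply, hT.apply_map, hT.proj_apply]

lemma Localizes.exists_isTruncatedInverse (hE : Localizes E K) (hK : IsSelfAdjoint K)
    (hinj : Function.Injective K) {p q : ℝ} (hpq : p ≤ q) :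
    ∃ T, IsTruncatedInverse K (increment E p q) T := by
  have hP := hE.isStarProjection_increment hpq
  have hdense := denseRange_of_isSelfAdjoint hK hinj
  have hbound : ∀ z, ‖increment E p q z‖ ≤ (|p| + (q - p)) * ‖K z‖ := fun z =>
    calc ‖increment E p q z‖ ≤ ‖(p : ℂ) • increment E p q (K z)‖ +
          ‖(p : ℂ) • increment E p q (K z) - increment E p q z‖ := norm_le_insert _ _
      _ ≤ |p| * ‖increment E p q (K z)‖ + (q - p) * ‖increment E p q (K z)‖ := by
          rw [norm_smul, Complex.norm_real, Real.norm_eq_abs]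
          gcongr
          exact hE.norm_smul_sub_le le_rfl hpq z
      _ ≤ (|p| + (q - p)) * ‖K z‖ := by
          rw [← add_mul]
          gcongr
          exact hE.norm_increment_le hpq (K z)
  let T := (increment E p q : 𝒳 →ₗ[ℂ] 𝒳).extendOfNorm (K : 𝒳 →ₗ[ℂ] 𝒳)
  have hTK : ∀ z, T (K z) = increment E p q z :=
    LinearMap.extendOfNorm_eq hdense ⟨_, hbound⟩
  have hKT : ∀ z, K (T z) = increment E p q z := fun z =>
    hdense.induction_on z (isClosed_eq (by fun_prop) (by fun_prop)) fun w => by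
      rw [hTK, hE.apply_increment]
  have hPT : ∀ z, increment E p q (T z) = T z := fun z => hinj <| by
    rw [hE.apply_increment, hKT, hE.increment_increment_of_subset le_rfl hpq le_rfl]
  refine ⟨T, ContinuousLinearMap.isSelfAdjoint_iff_isSymmetric.2 fun x y => ?_, hKT, hTK, hPT⟩
  calc inner ℂ (T x) y = inner ℂ (T x) (K (T y)) := by
        rw [hKT, ← inner_apply_left hP.isSelfAdjoint, hPT]
    _ = inner ℂ x (T y) := by
        rw [← inner_apply_left hK, hKT, inner_apply_left hP.isSelfAdjoint, hPT]

lemma Localizes.norm_smul_sub_truncatedInverse_le (hE : Localizes E K) (hK : IsSelfAdjoint K)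
    (hinj : Function.Injective K) {p c q : ℝ} (hpc : p ≤ c) (hcq : c ≤ q)
    (hT : IsTruncatedInverse K (increment E p q) T) (z : 𝒳) :
    ‖(c : ℂ) • increment E p q z - T z‖ ≤ (q - p) * ‖increment E p q z‖ :=
  (denseRange_of_isSelfAdjoint hK hinj).induction_on z
    (isClosed_le (by fun_prop) (by fun_prop)) fun w => by
      rw [hT.apply_map]
      exact hE.norm_smul_sub_le hpc hcq w

end TruncatedInverse

section EvolutionEquation

variable {𝒳 : Type*} [NormedAddCommGroup 𝒳] [NormedSpace ℂ 𝒳]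

lemma hasDerivAt_clm_apply (L : 𝒳 →L[ℂ] 𝒳) {y : ℝ → 𝒳} {y' : 𝒳} {t : ℝ}
    (h : HasDerivAt y y' t) : HasDerivAt (fun t => L (y t)) (L y') t :=
  (L.restrictScalars ℝ).hasFDerivAt.comp_hasDerivAt t h

lemma norm_exp_neg_mul (c t : ℝ) : ‖Complex.exp (-(Complex.I * (c : ℂ) * (t : ℂ)))‖ = 1 := by
  rw [show -(Complex.I * (c : ℂ) * (t : ℂ)) = ((-(c * t) : ℝ) : ℂ) * Complex.I by push_cast; ring]
  exact Complex.norm_exp_ofReal_mul_I _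

lemma norm_exp_smul_sub_le {w w' : ℝ → 𝒳} (hw : ∀ t, HasDerivAt w (w' t) t) {c C : ℝ}
    (hC : ∀ t, ‖w' t + (Complex.I * (c : ℂ)) • w t‖ ≤ C) (t : ℝ) :
    ‖Complex.exp (-(Complex.I * (c : ℂ) * (t : ℂ))) • w 0 - w t‖ ≤ C * |t| := by
  have hexp : ∀ s : ℝ, HasDerivAt (fun s : ℝ => Complex.exp (Complex.I * (c : ℂ) * (s : ℂ)))
      (Complex.exp (Complex.I * (c : ℂ) * (s : ℂ)) * (Complex.I * (c : ℂ) * 1)) s := fun s =>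
    ((Complex.ofRealCLM.hasDerivAt (x := s)).const_mul (Complex.I * (c : ℂ))).cexp
  have hnorm : ∀ s : ℝ, ‖Complex.exp (Complex.I * (c : ℂ) * (s : ℂ))‖ = 1 := fun s => by
    simpa using norm_exp_neg_mul (-c) s
  have hderiv : ∀ s : ℝ, ‖Complex.exp (Complex.I * (c : ℂ) * (s : ℂ)) • w' s +
      (Complex.exp (Complex.I * (c : ℂ) * (s : ℂ)) * (Complex.I * (c : ℂ) * 1)) • w s‖ ≤ C :=
    fun s => by
      rw [mul_one, mul_smul, ← smul_add, norm_smul, hnorm, one_mul]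
      exact hC s
  have hmv := convex_univ.norm_image_sub_le_of_norm_hasDerivWithin_le (x := 0) (y := t)
    (fun s _ => ((hexp s).smul (hw s)).hasDerivWithinAt) (fun s _ => hderiv s)
    (mem_univ _) (mem_univ _)
  have hrotate : Complex.exp (-(Complex.I * (c : ℂ) * (t : ℂ))) • w 0 - w t =
      -(Complex.exp (-(Complex.I * (c : ℂ) * (t : ℂ))) •
        (Complex.exp (Complex.I * (c : ℂ) * (t : ℂ)) • w t -
          Complex.exp (Complex.I * (c : ℂ) * ((0 : ℝ) : ℂ)) • w 0)) := by
    rw [smul_sub, smul_smul, ← Complex.exp_add, neg_add_cancel, Complex.exp_zero, one_smul,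
      Complex.ofReal_zero, mul_zero, Complex.exp_zero, one_smul, neg_sub]
  rw [hrotate, norm_neg, norm_smul, norm_exp_neg_mul, one_mul]
  rwa [sub_zero, Real.norm_eq_abs] at hmv

lemma hasDerivAt_exp_smul_apply [CompleteSpace 𝒳] (A : 𝒳 →L[ℂ] 𝒳) (z : 𝒳) (t : ℝ) :
    HasDerivAt (fun t : ℝ => NormedSpace.exp (t • A) z) (A (NormedSpace.exp (t • A) z)) t :=
  ((ContinuousLinearMap.apply ℂ 𝒳 z).restrictScalars ℝ).hasFDerivAt.comp_hasDerivAt t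
    (hasDerivAt_exp_smul_const' (𝕂 := ℝ) A t)

variable {K : 𝒳 →L[ℂ] 𝒳}

/-- `Y` is continuous and solves the equation `i Y' = H Y` with `H = K⁻¹`, integrated and
multiplied by `K`. -/
structure IsIntegralSolution (K : 𝒳 →L[ℂ] 𝒳) (Y : ℝ → 𝒳) : Prop where
  continuous : Continuous Y
  integral_eq : ∀ t : ℝ, ∫ s in (0 : ℝ)..t, Y s = Complex.I • K (Y t - Y 0)

lemma IsIntegralSolution.sub {Y Z : ℝ → 𝒳} (hY : IsIntegralSolution K Y)
    (hZ : IsIntegralSolution K Z) : IsIntegralSolution K (Y - Z) where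
  continuous := hY.continuous.sub hZ.continuous
  integral_eq t := by
    simp only [Pi.sub_apply]
    rw [intervalIntegral.integral_sub (hY.continuous.intervalIntegrable 0 t)
      (hZ.continuous.intervalIntegrable 0 t), hY.integral_eq, hZ.integral_eq, ← smul_sub, ← map_sub,
      sub_sub_sub_comm]

lemma IsIntegralSolution.of_tendstoUniformly {y : ℕ → ℝ → 𝒳} {Y : ℝ → 𝒳}
    (hy : ∀ n, IsIntegralSolution K (y n)) (hunif : TendstoUniformly y Y atTop) :
    IsIntegralSolution K Y where
  continuous :=
    hunif.continuous (Eventually.of_forall fun n => (hy n).continuous).frequently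
  integral_eq t := by
    have hint : Tendsto (fun n => ∫ s in (0 : ℝ)..t, y n s) atTop (𝓝 (∫ s in (0 : ℝ)..t, Y s)) :=
      hunif.tendstoUniformlyOn.tendsto_intervalIntegral_of_continuousOn
        (Eventually.of_forall fun n => (hy n).continuous.continuousOn)
    have hmap := ((K.continuous.tendsto _).comp
      ((hunif.tendsto_at t).sub (hunif.tendsto_at 0))).const_smul Complex.I
    exact tendsto_nhds_unique hint (hmap.congr fun n => ((hy n).integral_eq t).symm)

end EvolutionEquation

section SpectralDynamics

variable {𝒳 : Type*} [NormedAddCommGroup 𝒳] [InnerProductSpace ℂ 𝒳] [CompleteSpace 𝒳]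
  {E : ℝ → 𝒳 →L[ℂ] 𝒳} {K P T : 𝒳 →L[ℂ] 𝒳} {Y : ℝ → 𝒳}

lemma norm_eq_of_hasDerivAt (hT : IsSelfAdjoint T) {w : ℝ → 𝒳}
    (hw : ∀ t, HasDerivAt w (-(Complex.I • T (w t))) t) (t : ℝ) : ‖w t‖ = ‖w 0‖ := by
  have hderiv : ∀ t, HasDerivAt (fun t => inner ℂ (w t) (w t)) 0 t := fun t => by
    have hzero : inner ℂ (w t) (-(Complex.I • T (w t))) +
        inner ℂ (-(Complex.I • T (w t))) (w t) = 0 := by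
      rw [inner_neg_right, inner_neg_left, inner_smul_left, inner_smul_right,
        inner_apply_left hT, Complex.conj_I]
      ring
    exact hzero ▸ (hw t).inner ℂ (hw t)
  have hconst := is_const_of_deriv_eq_zero (fun t => (hderiv t).differentiableAt)
    (fun t => (hderiv t).deriv) t 0
  rw [inner_self_eq_norm_sq_to_K, inner_self_eq_norm_sq_to_K] at hconst
  exact (sq_eq_sq₀ (norm_nonneg _) (norm_nonneg _)).1 (by exact_mod_cast hconst)

lemma IsTruncatedInverse.exists_isIntegralSolution (hT : IsTruncatedInverse K P T) (z : 𝒳) :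
    ∃ Y, IsIntegralSolution K Y ∧ Y 0 = P z := by
  let y : ℝ → 𝒳 := fun t => NormedSpace.exp (t • -(Complex.I • T)) z
  have hy : ∀ t, HasDerivAt y (-(Complex.I • T (y t))) t :=
    hasDerivAt_exp_smul_apply (-(Complex.I • T)) z
  have hcont : Continuous fun t => P (y t) :=
    P.continuous.comp (continuous_iff_continuousAt.2 fun t => (hy t).continuousAt)
  have hprimitive : ∀ t, HasDerivAt (fun t => Complex.I • K (P (y t))) (P (y t)) t := fun t => by
    have h := (hasDerivAt_clm_apply K (hasDerivAt_clm_apply P (hy t))).const_smul Complex.I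
    rwa [map_neg, map_smul, hT.proj_apply, map_neg, map_smul, hT.map_apply, smul_neg, smul_smul,
      Complex.I_mul_I, neg_smul, one_smul, neg_neg] at h
  refine ⟨fun t => P (y t), ⟨hcont, fun t => ?_⟩, ?_⟩
  · rw [intervalIntegral.integral_eq_sub_of_hasDerivAt (fun s _ => hprimitive s)
      (hcont.intervalIntegrable 0 t), map_sub, smul_sub]
  · simp only [y, zero_smul, NormedSpace.exp_zero, one_apply_eq_self]

lemma IsIntegralSolution.hasDerivAt_proj (hY : IsIntegralSolution K Y)
    (hT : IsTruncatedInverse K P T) (t : ℝ) :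
    HasDerivAt (fun t => P (Y t)) (-(Complex.I • T (P (Y t)))) t := by
  have hrepr : ∀ t, P (Y t) = P (Y 0) + -(Complex.I • ∫ s in (0 : ℝ)..t, T (Y s)) := fun t => by
    rw [T.intervalIntegral_comp_comm (hY.continuous.intervalIntegrable 0 t), hY.integral_eq,
      map_smul, hT.apply_map, smul_smul, Complex.I_mul_I, map_sub]
    module
  have hint := ((T.continuous.comp hY.continuous).integral_hasStrictDerivAt 0 t).hasDerivAt
  rw [hT.apply_proj, funext hrepr]
  exact (hint.const_smul Complex.I).neg.const_add (P (Y 0))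

variable (hE : Localizes E K) (hK : IsSelfAdjoint K) (hinj : Function.Injective K)
include hE hK hinj

lemma IsIntegralSolution.norm_increment_eq (hY : IsIntegralSolution K Y) {p q : ℝ} (hpq : p ≤ q)
    (t : ℝ) : ‖increment E p q (Y t)‖ = ‖increment E p q (Y 0)‖ := by
  obtain ⟨T, hT⟩ := hE.exists_isTruncatedInverse hK hinj hpq
  exact norm_eq_of_hasDerivAt hT.selfAdjoint (hY.hasDerivAt_proj hT) t

lemma IsIntegralSolution.norm_eq (hY : IsIntegralSolution K Y) (t : ℝ) : ‖Y t‖ = ‖Y 0‖ := by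
  refine tendsto_nhds_unique (hE.tendsto_increment (Y t)).norm
    ((hE.tendsto_increment (Y 0)).norm.congr' ?_)
  filter_upwards [eventually_Icc_subset 0 0] with x hx
  exact (hY.norm_increment_eq hE hK hinj (hx.1.trans hx.2) t).symm

lemma IsIntegralSolution.norm_exp_smul_sub_increment_le (hY : IsIntegralSolution K Y)
    {p c q : ℝ} (hpc : p ≤ c) (hcq : c ≤ q) (t : ℝ) :
    ‖Complex.exp (-(Complex.I * (c : ℂ) * (t : ℂ))) • increment E p q (Y 0) -
      increment E p q (Y t)‖ ≤ |t| * (q - p) * ‖increment E p q (Y 0)‖ := by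
  have hpq := hpc.trans hcq
  obtain ⟨T, hT⟩ := hE.exists_isTruncatedInverse hK hinj hpq
  refine (norm_exp_smul_sub_le (hY.hasDerivAt_proj hT) (c := c) (fun s => ?_) t).trans_eq
    (by rw [mul_comm, mul_assoc])
  rw [neg_add_eq_sub, mul_smul, ← smul_sub, norm_smul, Complex.norm_I, one_mul, hT.apply_proj,
    ← hY.norm_increment_eq hE hK hinj hpq s]
  exact hE.norm_smul_sub_truncatedInverse_le hK hinj hpc hcq hT (Y s)

lemma IsIntegralSolution.hasImproperRSIntegral (hY : IsIntegralSolution K Y) (t : ℝ) :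
    HasImproperRSIntegral (fun ω : ℝ => Complex.exp (-(Complex.I * (ω : ℂ) * (t : ℂ))))
      (fun ω => E ω (Y 0)) (Y t) :=
  hE.hasImproperRSIntegral_of_norm_sub_le fun hpc hcq =>
    hY.norm_exp_smul_sub_increment_le hE hK hinj hpc hcq t

lemma isClosed_initialValues : IsClosed {Y₀ | ∃ Y, IsIntegralSolution K Y ∧ Y 0 = Y₀} := by
  refine isSeqClosed_iff_isClosed.1 fun z Y₀ hz hlim => ?_
  choose y hy hy0 using hz
  have hdist : ∀ m n t, dist (y m t) (y n t) = dist (z m) (z n) := fun m n t => by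
    rw [dist_eq_norm, dist_eq_norm, ← hy0, ← hy0]
    exact ((hy m).sub (hy n)).norm_eq hE hK hinj t
  have hcauchy : UniformCauchySeqOn y atTop univ := by
    rw [Metric.uniformCauchySeqOn_iff]
    simp only [hdist]
    intro ε hε
    obtain ⟨N, hN⟩ := Metric.cauchySeq_iff.1 hlim.cauchySeq ε hε
    exact ⟨N, fun m hm n hn _ _ => hN m hm n hn⟩
  choose Y hY using fun t => cauchySeq_tendsto_of_complete (hcauchy.cauchySeq (mem_univ t))
  have hunif : TendstoUniformly y Y atTop :=
    tendstoUniformlyOn_univ.1 (hcauchy.tendstoUniformlyOn_of_tendsto fun t _ => hY t)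
  exact ⟨Y, .of_tendstoUniformly hy hunif, tendsto_nhds_unique (hY 0) (by simpa only [hy0])⟩

lemma Localizes.exists_isIntegralSolution (Y₀ : 𝒳) : ∃ Y, IsIntegralSolution K Y ∧ Y 0 = Y₀ := by
  refine (isClosed_initialValues hE hK hinj).mem_of_tendsto (hE.tendsto_increment Y₀) ?_
  filter_upwards [eventually_Icc_subset 0 0] with x hx
  obtain ⟨T, hT⟩ := hE.exists_isTruncatedInverse hK hinj (hx.1.trans hx.2)
  exact hT.exists_isIntegralSolution Y₀

end SpectralDynamics

section Hamilton

variable {𝒳 : Type*} [NormedAddCommGroup 𝒳] [InnerProductSpace ℂ 𝒳]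
  {B Λ : 𝒳 →ₗ.[ℂ] 𝒳} {R S : 𝒳 →L[ℂ] 𝒳}

/-- The unit `iJ` of the algebra of bounded operators. -/
def iMul (J : (𝒳 →L[ℂ] 𝒳)ˣ) : (𝒳 →L[ℂ] 𝒳)ˣ :=
  Units.mk0 Complex.I Complex.I_ne_zero • J

/-- The inverse `Λ⁻¹ (iJ)⁻¹ Λ⁻¹` of `H = Λ iJ Λ`, in terms of `S = Λ⁻¹`. -/
def schrodingerInverse (J : (𝒳 →L[ℂ] 𝒳)ˣ) (S : 𝒳 →L[ℂ] 𝒳) : 𝒳 →L[ℂ] 𝒳 :=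
  S * ↑(iMul J)⁻¹ * S

lemma HasInverse.schrodinger (hS : HasInverse Λ S) (J : (𝒳 →L[ℂ] 𝒳)ˣ) :
    HasInverse (schrodinger J Λ) (schrodingerInverse J S) :=
  hS.comp (hS.compPMap (iMul J))

lemma HasInverse.generator (hR : HasInverse B R) (J : (𝒳 →L[ℂ] 𝒳)ˣ) :
    HasInverse (generator J B) (R * ↑J⁻¹) :=
  hR.compPMap J

lemma I_smul_schrodingerInverse_apply (J : (𝒳 →L[ℂ] 𝒳)ˣ) (z : 𝒳) :
    Complex.I • schrodingerInverse J S z = S ((↑J⁻¹ : 𝒳 →L[ℂ] 𝒳) (S z)) := by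
  change Complex.I • S (Complex.I⁻¹ • (↑J⁻¹ : 𝒳 →L[ℂ] 𝒳) (S z)) = _
  rw [map_smul, smul_inv_smul₀ Complex.I_ne_zero]

variable [CompleteSpace 𝒳]

lemma isSelfAdjoint_schrodingerInverse {J : (𝒳 →L[ℂ] 𝒳)ˣ} (hS : IsSelfAdjoint S)
    (hJ : ContinuousLinearMap.adjoint (J : 𝒳 →L[ℂ] 𝒳) = -J) :
    IsSelfAdjoint (schrodingerInverse J S) := by
  have hiJ : IsSelfAdjoint (iMul J) := Units.ext <| by
    change star (Complex.I • (J : 𝒳 →L[ℂ] 𝒳)) = Complex.I • (J : 𝒳 →L[ℂ] 𝒳)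
    rw [star_smul, ContinuousLinearMap.star_eq_adjoint, hJ, smul_neg, ← neg_smul]
    simp
  exact IsSelfAdjoint.conjugate_self (congrArg Units.val hiJ.inv) hS

lemma isMildSolution_iff (hR : HasInverse B R) (hS : HasInverse Λ S) (hSR : S * S = R)
    (J : (𝒳 →L[ℂ] 𝒳)ˣ) (X : ℝ → Λ.domain) :
    IsMildSolution J B Λ X ↔ IsIntegralSolution (schrodingerInverse J S) (fun t => Λ (X t)) := by
  have hX : ∀ t, (X t : 𝒳) = S (Λ (X t)) := fun t => (hS.inverse_apply (X t)).symm
  have hequation : (Continuous fun t => Λ (X t)) → ∀ t,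
      ((∃ h : (∫ s in (0 : ℝ)..t, (X s : 𝒳)) ∈ (generator J B).domain,
        generator J B ⟨∫ s in (0 : ℝ)..t, (X s : 𝒳), h⟩ = (X t : 𝒳) - X 0) ↔
      ∫ s in (0 : ℝ)..t, Λ (X s) =
        Complex.I • schrodingerInverse J S (Λ (X t) - Λ (X 0))) := fun hcont t => by
    have hint : ∫ s in (0 : ℝ)..t, (X s : 𝒳) = S (∫ s in (0 : ℝ)..t, Λ (X s)) := by
      rw [← S.intervalIntegral_comp_comm (hcont.intervalIntegrable 0 t)]
      simp only [hX]
    have hsub : (R * ↑J⁻¹) ((X t : 𝒳) - X 0) =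
        S (S ((↑J⁻¹ : 𝒳 →L[ℂ] 𝒳) (S (Λ (X t) - Λ (X 0))))) := by
      rw [map_sub S, ← hX, ← hX, ← hSR]
      rfl
    rw [hR.generator, hint, I_smul_schrodingerInverse_apply, hsub, hS.injective.eq_iff]
    exact eq_comm
  constructor
  · rintro ⟨hcont, heq⟩
    refine ⟨hcont, fun t => (hequation hcont t).1 ?_⟩
    obtain ⟨hmem, h⟩ := heq t
    exact ⟨hmem, h.symm⟩
  · rintro ⟨hcont, heq⟩
    refine ⟨hcont, fun t => ?_⟩
    obtain ⟨hmem, h⟩ := (hequation hcont t).2 (heq t)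
    exact ⟨hmem, h.symm⟩

lemma exists_isMildSolution (hR : HasInverse B R) (hS : HasInverse Λ S) (hSR : S * S = R)
    (J : (𝒳 →L[ℂ] 𝒳)ˣ)
    (hex : ∀ Y₀, ∃ Y, IsIntegralSolution (schrodingerInverse J S) Y ∧ Y 0 = Y₀) (X₀ : Λ.domain) :
    ∃ X, IsMildSolution J B Λ X ∧ X 0 = X₀ := by
  obtain ⟨Y, hY, hY0⟩ := hex (Λ X₀)
  refine ⟨fun t => ⟨S (Y t), hS.mem (Y t)⟩, (isMildSolution_iff hR hS hSR J _).2 ?_,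
    Subtype.ext ?_⟩
  · simpa only [hS.apply_inverse] using hY
  · exact (congrArg S hY0).trans (hS.inverse_apply X₀)

end Hamilton

end ComplexHamilton

end

theorem proposition2p4_general {𝒳 : Type*} [NormedAddCommGroup 𝒳] [InnerProductSpace ℂ 𝒳]
    [CompleteSpace 𝒳]
    (B : 𝒳 →ₗ.[ℂ] 𝒳) (hB : IsSelfAdjoint B)
    (J : 𝒳 →L[ℂ] 𝒳) (hJ : ContinuousLinearMap.adjoint J = -J) (hJ' : IsUnit J)
    (hP : ComplexHamilton.spectrum B ⊆ (fun r : ℝ => (r : ℂ)) '' Set.Ioi 0) :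
    (∃ Λ : 𝒳 →ₗ.[ℂ] 𝒳, ComplexHamilton.IsPositiveSqrt Λ B) ∧
    ∀ Λ : 𝒳 →ₗ.[ℂ] 𝒳, ComplexHamilton.IsPositiveSqrt Λ B →
      Function.Bijective (fun x : Λ.domain => Λ x) ∧
      IsSelfAdjoint (ComplexHamilton.schrodinger J Λ) ∧
      (∃ E : ℝ → 𝒳 →L[ℂ] 𝒳,
        ComplexHamilton.IsSpectralResolution E (ComplexHamilton.schrodinger J Λ)) ∧
      (∀ X₀ : Λ.domain, ∃ X : ℝ → Λ.domain,
        ComplexHamilton.IsMildSolution J B Λ X ∧ X 0 = X₀) ∧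
      ∀ E : ℝ → 𝒳 →L[ℂ] 𝒳,
        ComplexHamilton.IsSpectralResolution E (ComplexHamilton.schrodinger J Λ) →
        ∀ X : ℝ → Λ.domain, ComplexHamilton.IsMildSolution J B Λ X →
        ∀ t : ℝ, ∃ (Z : 𝒳) (hZ : Z ∈ Λ.inverse.domain),
          ComplexHamilton.HasImproperRSIntegral
            (fun ω : ℝ => Complex.exp (-(Complex.I * (ω : ℂ) * (t : ℂ))))
            (fun ω : ℝ => E ω (Λ (X 0))) Z ∧
          (X t : 𝒳) = Λ.inverse ⟨Z, hZ⟩ := by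
  obtain ⟨J, rfl⟩ := hJ'
  have hres : ∀ r ≤ (0 : ℝ), (r : ℂ) ∈ ComplexHamilton.resolventSet B := fun r hr => by
    by_contra hspec
    obtain ⟨s, hs, hsr⟩ := hP hspec
    exact hr.not_gt (Complex.ofReal_injective hsr ▸ hs)
  obtain ⟨R, hR, hRsa⟩ := ComplexHamilton.exists_hasInverse_of_bijective hB
    (ComplexHamilton.bijective_of_zero_mem_resolventSet (by simpa using hres 0 le_rfl))
  refine ⟨hR.exists_isPositiveSqrt (hR.nonneg hRsa fun r hr => hres r hr.le), fun Λ hΛ => ?_⟩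
  obtain ⟨S, hS, hSsa, hSR⟩ := hΛ.exists_hasInverse hR
  have hH := hS.schrodinger J
  have hK := ComplexHamilton.isSelfAdjoint_schrodingerInverse hSsa hJ
  have hE := ComplexHamilton.localizes_spectralProj hK hH.injective
  refine ⟨hS.bijective, hH.isSelfAdjoint hK, ⟨_, hE.isSpectralResolution hH⟩,
    ComplexHamilton.exists_isMildSolution hR hS hSR J
      (hE.exists_isIntegralSolution hK hH.injective), fun E hE' X hX t => ?_⟩
  obtain ⟨hmem, hXt⟩ := hS.inverse_eq (X t)
  have hY := (ComplexHamilton.isMildSolution_iff hR hS hSR J X).1 hX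
  exact ⟨Λ (X t), hmem, hY.hasImproperRSIntegral (hE'.localizes hH) hK hH.injective t, hXt⟩

theorem proposition2p4 {𝒳 : Type*} [NormedAddCommGroup 𝒳] [InnerProductSpace ℂ 𝒳]
    [CompleteSpace 𝒳]
    (B : 𝒳 →ₗ.[ℂ] 𝒳) (hB : IsSelfAdjoint B)
    (J : 𝒳 →L[ℂ] 𝒳) (hJ : ContinuousLinearMap.adjoint J = -J)
    (hJ2 : J ∘L J = -ContinuousLinearMap.id ℂ 𝒳)
    (δ : ℝ) (hδ : 0 < δ)
    (hP : ComplexHamilton.spectrum B ⊆ (fun r : ℝ => (r : ℂ)) '' Set.Ici δ) :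
    (∃ Λ : 𝒳 →ₗ.[ℂ] 𝒳, ComplexHamilton.IsPositiveSqrt Λ B) ∧
    ∀ Λ : 𝒳 →ₗ.[ℂ] 𝒳, ComplexHamilton.IsPositiveSqrt Λ B →
      Function.Bijective (fun x : Λ.domain => Λ x) ∧
      IsSelfAdjoint (ComplexHamilton.schrodinger J Λ) ∧
      (∃ E : ℝ → 𝒳 →L[ℂ] 𝒳,
        ComplexHamilton.IsSpectralResolution E (ComplexHamilton.schrodinger J Λ)) ∧
      (∀ X₀ : Λ.domain, ∃ X : ℝ → Λ.domain,
        ComplexHamilton.IsMildSolution J B Λ X ∧ X 0 = X₀) ∧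
      ∀ E : ℝ → 𝒳 →L[ℂ] 𝒳,
        ComplexHamilton.IsSpectralResolution E (ComplexHamilton.schrodinger J Λ) →
        ∀ X : ℝ → Λ.domain, ComplexHamilton.IsMildSolution J B Λ X →
        ∀ t : ℝ, ∃ (Z : 𝒳) (hZ : Z ∈ Λ.inverse.domain),
          ComplexHamilton.HasImproperRSIntegral
            (fun ω : ℝ => Complex.exp (-(Complex.I * (ω : ℂ) * (t : ℂ))))
            (fun ω : ℝ => E ω (Λ (X 0))) Z ∧
          (X t : 𝒳) = Λ.inverse ⟨Z, hZ⟩ :=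
  have hJJ : J * -J = 1 := by rw [mul_neg]; exact neg_eq_iff_eq_neg.2 hJ2
  proposition2p4_general B hB J hJ (isUnit_iff_exists.2 ⟨-J, hJJ, (neg_mul_comm J J).trans hJJ⟩)
    (hP.trans (Set.image_mono (Set.Ici_subset_Ioi.2 hδ)))
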